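/- Let $\mathbb H$ be the skew field of quaternions with its Euclidean norm, let $\mathbb S=\{I\in\mathbb H : \operatorname{Re} I=0,\ \|I\|=1\}$, and for $I\in\mathbb S$ put $\mathbb C_I=\{x+Iy : x,y\in\mathbb R\}$. Let $\overline{\mathbb H}=\mathbb H\cup\{\infty\}$ and $\overline{\mathbb C_I}=\mathbb C_I\cup\{\infty\}$ be the one-point compactifications. A set $U\subseteq\mathbb H$ is axially symmetric if $x+Iy\in U$ with $x,y\in\mathbb R$, $I\in\mathbb S$ implies $x+Jy\in U$ for all $J\in\mathbb S$. A function $f$ is slice regular in an open set $U\subseteq\mathbb H$ if it is real differentiable in $U$ and, for every $I\in\mathbb S$, its restriction $f_I$ to $U\cap\mathbb C_I$ satisfies $\frac12\left(\frac{\partial}{\partial x}+I\frac{\partial}{\partial y}\right)f_I(x+Iy)=0$ on $U\cap\mathbb C_I$. A polynomial is a function $q\mapsto\sum_{k=0}^n q^k a_k$ with $a_0,\dots,a_n\in\mathbb H$. **Theorem.** Let $\Sigma\subset\mathbb H$ be a bounded region (a nonempty, connected open set) that is starlike with respect to the origin (that is, $tq\in\Sigma$ for all $q\in\Sigma$ and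 $t\in[0,1]$) and is the interior of its closure $\overline\Sigma$. Suppose that $\overline\Sigma$ is axially symmetric, that $\overline{\mathbb H}\setminus\overline\Sigma$ is connected, and that $\overline{\mathbb C_I}\setminus(\overline\Sigma\cap\mathbb C_I)$ is connected for every $I\in\mathbb S$. Let $f:\overline\Sigma\to\mathbb H$ be continuous on $\overline\Sigma$ and slice regular in $\Sigma$. Then for every $\varepsilon>0$ there is a polynomial $P$ such that $\|f(q)-P(q)\|<\varepsilon$ for all $q\in\overline\Sigma$. -/

import Mathlib

open Quaternion Topology

noncomputable section

/-- The sphere `𝕊` of purely imaginary unit quaternions. -/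
def imagUnits : Set ℍ[ℝ] := {I | I.re = 0 ∧ ‖I‖ = 1}

/-- The point `x + I y`, for `x`, `y` real. -/
def slicePoint (I : ℍ[ℝ]) (x y : ℝ) : ℍ[ℝ] := (x : ℍ[ℝ]) + I * (y : ℍ[ℝ])

/-- The slice `ℂ_I = {x + I y | x, y ∈ ℝ}`. -/
def complexSlice (I : ℍ[ℝ]) : Set ℍ[ℝ] := {q | ∃ x y : ℝ, q = slicePoint I x y}

/-- `U` contains, with `x + I y`, the whole sphere `x + 𝕊 y`. -/
def IsAxiallySymmetric (U : Set ℍ[ℝ]) : Prop :=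
  ∀ I ∈ imagUnits, ∀ x y : ℝ, slicePoint I x y ∈ U →
    ∀ J ∈ imagUnits, slicePoint J x y ∈ U

/-- The operator `½ (∂/∂x + I ∂/∂y)` applied to the restriction of `f` to `ℂ_I`,
at the point `x + I y`. -/
def sliceDbar (f : ℍ[ℝ] → ℍ[ℝ]) (I : ℍ[ℝ]) (x y : ℝ) : ℍ[ℝ] :=
  (1 / 2 : ℝ) • (deriv (fun t : ℝ => f (slicePoint I t y)) x +
    I * deriv (fun t : ℝ => f (slicePoint I x t)) y)

/-- `f` is slice regular in the open set `U`: it is real differentiable in `U` and all its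
restrictions to the slices satisfy the Cauchy-Riemann equation. -/
def IsSliceRegularOn (f : ℍ[ℝ] → ℍ[ℝ]) (U : Set ℍ[ℝ]) : Prop :=
  DifferentiableOn ℝ f U ∧
    ∀ I ∈ imagUnits, ∀ x y : ℝ, slicePoint I x y ∈ U → sliceDbar f I x y = 0

/-- The polynomial `∑_{k ≤ n} q ^ k a_k`, with coefficients on the right. -/
def rightPoly (n : ℕ) (a : ℕ → ℍ[ℝ]) (q : ℍ[ℝ]) : ℍ[ℝ] :=
  ∑ k ∈ Finset.range (n + 1), q ^ k * a k

/-- The complement of `K` in the extended space `ℍ ∪ {∞}`. -/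
def extendedComplement (K : Set ℍ[ℝ]) : Set (OnePoint ℍ[ℝ]) :=
  ((fun q : ℍ[ℝ] => (q : OnePoint ℍ[ℝ])) '' K)ᶜ

/-- The complement of `K ∩ ℂ_I` in the extended slice `ℂ_I ∪ {∞}`. -/
def extendedSliceComplement (I : ℍ[ℝ]) (K : Set ℍ[ℝ]) : Set (OnePoint (complexSlice I)) :=
  ((fun z : complexSlice I => (z : OnePoint (complexSlice I))) ''
    {z : complexSlice I | (z : ℍ[ℝ]) ∈ K})ᶜ

end

/-! The problem reduces to one complex slice. The representation formula
(`IsSliceRegularOn.eq_sliceRep`) expresses the value of a slice regular function at `x + Jy` through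
its values at `x + iy` and `x - iy`, with an operator of norm at most one on each value. Polynomials
with right coefficients obey the same formula, so an approximation on the slice of `i` spreads to
all slices, and then to the closure by continuity. On that slice, `f` splits as `F + G j` with `F`,
`G` complex valued, continuous on the planar compact set `K`, and holomorphic in its interior.
Complex polynomials near `F` and `G` combine into one quaternionic polynomial. What remains is
Mergelyan's theorem for a starlike `K`.

For that theorem, extend `f` continuously with compact support and rescale, so that it oscillates by
at most `ω` at distance one. Mollifying at scale one gives a smooth `Φ` within `ω` of `f`, whose
`∂/∂z̄` is `O(ω)` and vanishes at points whose unit disc lies in `K`. By Cauchy-Pompeiu, `Φ` is the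
Cauchy transform of this derivative, which lives near the complement of `K`. So it suffices to
replace `1/(z - ζ)`, for `ζ` near some `p ∉ K`, by a uniform limit of polynomials on `K`, with an
error whose integral in `ζ` is bounded by an absolute constant.

The replacement is `g + (ζ - c) g ^ 2`, where `g` is the inverse Joukowski map of the complement of
a radial segment that starts at `p` and so avoids `K`. It agrees with the Cauchy kernel to third
order at infinity, hence the integrable error. Starlikeness gives `g` explicitly through two square
roots, which are uniform limits of polynomials because rays from points outside `K` never return to
`K`. -/

/-! ### Inverses, logarithms and square roots in the closed algebra generated by the polynomials. -/

/-- The uniform closure of the polynomials in `C(K, ℂ)`. -/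
noncomputable abbrev polyClosure (K : Set ℂ) [CompactSpace K] : Subalgebra ℂ C(K, ℂ) :=
  (polynomialFunctions K).topologicalClosure

section PolyClosure

variable {K : Set ℂ} [CompactSpace K]

theorem isClosed_polyClosure : IsClosed (polyClosure K : Set C(K, ℂ)) :=
  Subalgebra.isClosed_topologicalClosure _

theorem toContinuousMapOn_mem_polyClosure (P : Polynomial ℂ) :
    P.toContinuousMapOn K ∈ polyClosure K :=
  Subalgebra.le_topologicalClosure _ ⟨P, by simp, rfl⟩

theorem exists_poly_of_mem_polyClosure {φ : C(K, ℂ)} (hφ : φ ∈ polyClosure K) {ε : ℝ}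
    (hε : 0 < ε) : ∃ P : Polynomial ℂ, ∀ z : K, ‖φ z - P.eval (z : ℂ)‖ < ε := by
  obtain ⟨ψ, ⟨P, -, rfl⟩, hP⟩ := Metric.mem_closure_iff.1 hφ ε hε
  refine ⟨P, fun z => ?_⟩
  rw [dist_eq_norm] at hP
  exact lt_of_le_of_lt ((φ - P.toContinuousMapOn K).norm_coe_le_norm z) hP

omit [CompactSpace K] in
theorem ne_zero_of_notMem_of_zero_mem {p : ℂ} (h0 : (0 : ℂ) ∈ K) (hp : p ∉ K) : p ≠ 0 :=
  fun h => hp (h ▸ h0)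

omit [CompactSpace K] in
theorem smul_notMem_of_starConvex (hstar : StarConvex ℝ (0 : ℂ) K) {p : ℂ} (hp : p ∉ K)
    {s : ℝ} (hs : 1 ≤ s) : (s : ℂ) * p ∉ K := fun h => hp <| by
  have := hstar.smul_mem h (t := s⁻¹) (by positivity) (inv_le_one_of_one_le₀ hs)
  have hs0 : (s : ℂ) ≠ 0 := by exact_mod_cast (by positivity : s ≠ 0)
  simpa [hs0] using this

/-- Passing to a closed subalgebra can only fill bounded components of the complement of the
spectrum. The spectrum of `z` in `C(K, ℂ)` is `K`, and the ray from `p` away from `0` puts `p` in an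
unbounded component, so `p - z` stays invertible in the subalgebra. -/
theorem exists_inv_mem_polyClosure (hstar : StarConvex ℝ (0 : ℂ) K) (h0 : (0 : ℂ) ∈ K)
    {p : ℂ} (hp : p ∉ K) : ∃ e ∈ polyClosure K, ∀ z : K, e z * (p - z) = 1 := by
  have hp0 := ne_zero_of_notMem_of_zero_mem h0 hp
  set x : polyClosure K := ⟨_, toContinuousMapOn_mem_polyClosure Polynomial.X⟩ with hx
  have hspec : spectrum ℂ (x : C(K, ℂ)) = K := by
    rw [ContinuousMap.spectrum_eq_range]
    ext w
    simp [hx]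
  have hnot : p ∉ spectrum ℂ x := by
    intro hmem
    have : IsClosed ((polyClosure K : Subalgebra ℂ C(K, ℂ)) : Set C(K, ℂ)) := isClosed_polyClosure
    have hb := Subalgebra.spectrum_isBounded_connectedComponentIn (polyClosure K) x hmem
    rw [hspec] at hb
    have hray : (fun s : ℝ => (s : ℂ) * p) '' Set.Ici 1 ⊆ connectedComponentIn Kᶜ p := by
      refine IsPreconnected.subset_connectedComponentIn ?_ ⟨1, by simp, by simp⟩ ?_
      · exact isPreconnected_Ici.image _ (by fun_prop)
      · rintro _ ⟨s, hs, rfl⟩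
        exact smul_notMem_of_starConvex hstar hp hs
    obtain ⟨C, hC⟩ := (hb.subset hray).exists_norm_le
    have h1 := hC _ ⟨max 1 ((C + 1) / ‖p‖), Set.mem_Ici.2 (le_max_left _ _), rfl⟩
    have h2 : 0 < ‖p‖ := norm_pos_iff.2 hp0
    rw [norm_mul, Complex.norm_real, Real.norm_eq_abs, abs_of_pos (by positivity)] at h1
    have h3 := mul_le_mul_of_nonneg_right (le_max_right 1 ((C + 1) / ‖p‖)) h2.le
    rw [div_mul_cancel₀ _ h2.ne'] at h3
    linarith
  rw [spectrum.notMem_iff] at hnot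
  obtain ⟨e, he⟩ := hnot.exists_left_inv
  refine ⟨e, e.2, fun z => ?_⟩
  have := congrArg (fun y : polyClosure K => (y : C(K, ℂ)) z) he
  simpa [hx] using this

omit [CompactSpace K] in
theorem one_sub_mul_div_ne_zero (hstar : StarConvex ℝ (0 : ℂ) K) (h0 : (0 : ℂ) ∈ K)
    {p : ℂ} (hp : p ∉ K) (z : K) {s : ℝ} (hs : s ∈ Set.Icc (0 : ℝ) 1) :
    1 - (s : ℂ) * (z / p) ≠ 0 := by
  intro h
  have hp0 := ne_zero_of_notMem_of_zero_mem h0 hp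
  have h1 : (s : ℂ) * z = p := by
    field_simp at h
    linear_combination -h
  apply hp
  rw [← h1]
  simpa using hstar.smul_mem z.2 hs.1 hs.2

omit [CompactSpace K] in
theorem one_sub_div_mem_slitPlane (hstar : StarConvex ℝ (0 : ℂ) K) (h0 : (0 : ℂ) ∈ K)
    {p : ℂ} (hp : p ∉ K) (z : K) {s : ℝ} (hs : s ∈ Set.Icc (0 : ℝ) 1) :
    1 - (s : ℂ) * (z / p) ∈ Complex.slitPlane := by
  rw [Complex.mem_slitPlane_iff]
  by_contra! hcon
  set w : ℂ := z / p with hw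
  have hre : (1 - (s : ℂ) * w).re = 1 - s * w.re := by simp
  have him : (1 - (s : ℂ) * w).im = - (s * w.im) := by simp
  rw [hre, him] at hcon
  have h1 : 1 ≤ s * w.re := by linarith
  have hpos : 0 < s * w.re := by linarith
  have h2 : (s * (s * w.re)⁻¹) * w.re = 1 := by
    field_simp
    have : s ≠ 0 := by rintro rfl; simp at hpos
    have : w.re ≠ 0 := by intro h; simp [h] at hpos
    field_simp
  -- If `1 - s w` were a nonpositive real, `s w` would be a real at least `1`. Dividing by it gives
  -- a parameter in `[0, 1]` at which `1 - s w` vanishes.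
  refine one_sub_mul_div_ne_zero hstar h0 hp z (s := s * (s * w.re)⁻¹)
    ⟨mul_nonneg hs.1 (by positivity), mul_le_one₀ hs.2 (by positivity) (inv_le_one_of_one_le₀ h1)⟩ ?_
  apply Complex.ext
  · rw [← hw, Complex.sub_re, Complex.re_ofReal_mul, h2]; simp
  · rw [← hw, Complex.sub_im, Complex.im_ofReal_mul, mul_right_comm]
    have : s * w.im = 0 := by linarith [hcon.2]
    rw [this]; simp

/-- The logarithm is the integral over `s ∈ [0, 1]` of its derivative along the segment from `0` to
`z`. Each integrand is in the closed subalgebra, hence so is their integral. -/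
theorem exists_log_mem_polyClosure (hstar : StarConvex ℝ (0 : ℂ) K) (h0 : (0 : ℂ) ∈ K)
    {p : ℂ} (hp : p ∉ K) : ∃ e ∈ polyClosure K, ∀ z : K, e z = Complex.log (1 - z / p) := by
  have hp0 := ne_zero_of_notMem_of_zero_mem h0 hp
  let F : C(unitInterval × K, ℂ) :=
    ⟨fun q => -((q.2 : ℂ) / p) / (1 - ((q.1 : ℝ) : ℂ) * (q.2 / p)), by
      refine Continuous.div (by fun_prop) (by fun_prop) fun q => ?_
      exact one_sub_mul_div_ne_zero hstar h0 hp q.2 q.1.2⟩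
  have hFmem : ∀ s, F.curry s ∈ polyClosure K := by
    -- For `s > 0` the integrand is `-(z / s) / (p / s - z)`, and `p / s` is again outside `K`. At
    -- `s = 0` it is a polynomial.
    intro s
    rcases eq_or_lt_of_le s.2.1 with hs | hs
    · convert toContinuousMapOn_mem_polyClosure (K := K) (Polynomial.C (-p⁻¹) * Polynomial.X) using 1
      ext z
      simp [F, ← hs, div_eq_inv_mul]
    · have hs0 : ((s : ℝ) : ℂ) ≠ 0 := by exact_mod_cast hs.ne'
      have hps : (((s : ℝ)⁻¹ : ℝ) : ℂ) * p ∉ K :=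
        smul_notMem_of_starConvex hstar hp ((one_le_inv₀ hs).2 s.2.2)
      obtain ⟨e, he, hez⟩ := exists_inv_mem_polyClosure hstar h0 hps
      convert mul_mem he (toContinuousMapOn_mem_polyClosure (K := K)
        (Polynomial.C (-((s : ℝ) : ℂ)⁻¹) * Polynomial.X)) using 1
      ext z
      have h1 := hez z
      push_cast at h1
      have h3 : (((s : ℝ) : ℂ)⁻¹ * p - z) ≠ 0 := right_ne_zero_of_mul_eq_one h1
      have h4 : p - s * z ≠ 0 := by
        contrapose! h3
        field_simp
        simpa using h3
      simp only [ContinuousMap.curry_apply, ContinuousMap.mul_apply, F, ContinuousMap.coe_mk]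
      rw [eq_div_of_mul_eq h3 h1]
      simp
      field_simp
  refine ⟨∫ s, F.curry s, ?_, fun z => ?_⟩
  · refine Convex.integral_mem (s := (polyClosure K : Set C(K, ℂ)))
      ((polyClosure K).toSubmodule.restrictScalars ℝ).convex isClosed_polyClosure
      (.of_forall hFmem) ?_
    exact F.curry.continuous.integrable_of_hasCompactSupport (.of_compactSpace _)
  · rw [ContinuousMap.integral_apply
      (F.curry.continuous.integrable_of_hasCompactSupport (.of_compactSpace _))]
    simp only [ContinuousMap.curry_apply, F, ContinuousMap.coe_mk]
    have h1 := MeasureTheory.integral_subtype 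
      (measurableSet_Icc : MeasurableSet (Set.Icc (0 : ℝ) 1))
      (fun s : ℝ => -((z : ℂ) / p) / (1 - (s : ℂ) * (z / p)))
    refine h1.trans ?_
    rw [MeasureTheory.integral_Icc_eq_integral_Ioc, ← intervalIntegral.integral_of_le zero_le_one,
      intervalIntegral.integral_eq_sub_of_hasDerivAt
        (f := fun s : ℝ => Complex.log (1 - (s : ℂ) * (z / p)))]
    · simp
    · intro s hs
      rw [Set.uIcc_of_le zero_le_one] at hs
      have h2 : HasDerivAt (fun s : ℝ => 1 - (s : ℂ) * (z / p)) (-((z : ℂ) / p)) s := by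
        simpa using ((Complex.ofRealCLM.hasDerivAt (x := s)).mul_const ((z : ℂ) / p)).const_sub 1
      exact h2.clog_real (one_sub_div_mem_slitPlane hstar h0 hp z hs)
    · apply ContinuousOn.intervalIntegrable
      rw [Set.uIcc_of_le zero_le_one]
      exact ContinuousOn.div (by fun_prop) (by fun_prop)
        fun s hs => one_sub_mul_div_ne_zero hstar h0 hp z hs

theorem exp_mem_polyClosure {e : C(K, ℂ)} (he : e ∈ polyClosure K) :
    ∃ x ∈ polyClosure K, ∀ z : K, x z = Complex.exp (e z) := by
  have hsum := NormedSpace.exp_series_hasSum_exp' (𝕂 := ℂ) e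
  refine ⟨_, isClosed_polyClosure.mem_of_tendsto hsum (.of_forall fun s =>
    sum_mem fun n _ => Subalgebra.smul_mem _ (pow_mem he n) _), fun z => ?_⟩
  have h1 := hsum.map (ContinuousMap.evalCLM ℂ z) (ContinuousMap.evalCLM ℂ z).continuous
  have h2 := NormedSpace.exp_series_hasSum_exp' (𝕂 := ℂ) (e z)
  rw [Complex.exp_eq_exp_ℂ]
  exact h1.unique (h2.congr_fun fun n => by simp)

theorem exists_sqrt_mem_polyClosure (hstar : StarConvex ℝ (0 : ℂ) K) (h0 : (0 : ℂ) ∈ K)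
    {p : ℂ} (hp : p ∉ K) :
    ∃ e ∈ polyClosure K, ∀ z : K, e z = Complex.exp (Complex.log (1 - z / p) / 2) := by
  obtain ⟨l, hl, hlz⟩ := exists_log_mem_polyClosure hstar h0 hp
  obtain ⟨x, hx, hxz⟩ := exp_mem_polyClosure (Subalgebra.smul_mem _ hl (1 / 2 : ℂ))
  refine ⟨x, hx, fun z => ?_⟩
  rw [hxz, ContinuousMap.smul_apply, hlz]
  congr 1
  rw [smul_eq_mul]; ring

end PolyClosure

/-! ### The Joukowski kernel of a segment. -/

theorem exp_half_log_sq {w : ℂ} (hw : w ≠ 0) : Complex.exp (Complex.log w / 2) ^ 2 = w := by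
  rw [← Complex.exp_nat_mul, Nat.cast_ofNat, mul_div_cancel₀ _ two_ne_zero, Complex.exp_log hw]

/-- Square roots of two numbers in the same half plane are at an angle of at most `π / 2`. -/
theorem norm_exp_half_log_sub_le {v w : ℂ} (h : (0 ≤ v.im ∧ 0 ≤ w.im) ∨ (v.im < 0 ∧ w.im < 0)) :
    ‖Complex.exp (Complex.log w / 2) - Complex.exp (Complex.log v / 2)‖ ≤
      ‖Complex.exp (Complex.log w / 2) + Complex.exp (Complex.log v / 2)‖ := by
  have harg : |w.arg / 2 - v.arg / 2| ≤ Real.pi / 2 := by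
    rw [abs_le]
    have := Complex.arg_le_pi v
    have := Complex.arg_le_pi w
    have := Complex.neg_pi_lt_arg v
    have := Complex.neg_pi_lt_arg w
    rcases h with ⟨h1, h2⟩ | ⟨h1, h2⟩
    · have := Complex.arg_nonneg_iff.2 h1
      have := Complex.arg_nonneg_iff.2 h2
      constructor <;> linarith
    · have := Complex.arg_neg_iff.2 h1
      have := Complex.arg_neg_iff.2 h2
      constructor <;> linarith
  have hcos : 0 ≤ Real.cos (w.arg / 2 - v.arg / 2) :=
    Real.cos_nonneg_of_mem_Icc (abs_le.1 harg |>.imp (by intro h; linarith) id)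
  rw [Real.cos_sub] at hcos
  rw [← sq_le_sq₀ (norm_nonneg _) (norm_nonneg _), Complex.sq_norm, Complex.sq_norm,
    Complex.normSq_apply, Complex.normSq_apply]
  have hv : (Complex.log v / 2).im = v.arg / 2 := by simp [Complex.log_im]
  have hw : (Complex.log w / 2).im = w.arg / 2 := by simp [Complex.log_im]
  simp only [Complex.sub_re, Complex.add_re, Complex.sub_im, Complex.add_im, Complex.exp_re,
    Complex.exp_im, hv, hw]
  have h3 := mul_nonneg (mul_pos (Real.exp_pos (Complex.log w / 2).re)
    (Real.exp_pos (Complex.log v / 2).re)).le hcos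
  nlinarith [h3]

/-- For a starlike compact set `K` and `p ∉ K`, the function inverse to the Joukowski map of the
complement of a radial segment of length `4` which starts from `p`. -/
theorem exists_segment_kernel {K : Set ℂ} [CompactSpace K] (hstar : StarConvex ℝ (0 : ℂ) K)
    (h0 : (0 : ℂ) ∈ K) {p : ℂ} (hp : p ∉ K) :
    ∃ g ∈ polyClosure K, ∃ c ρ : ℂ, ‖c - p‖ = 2 ∧ ‖ρ‖ = 1 ∧
      ∀ z : K, (z - c) * g z = 1 + ρ ^ 2 * g z ^ 2 ∧ ‖ρ * g z‖ ≤ 1 := by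
  have hp0 := ne_zero_of_notMem_of_zero_mem h0 hp
  have hnp : 0 < ‖p‖ := norm_pos_iff.2 hp0
  -- The segment from `p` to `t p` has length `4`, unit direction `ρ = p / ‖p‖` and midpoint `c = p
  -- + 2ρ`. Its ends `c ± 2ρ` are the critical values of `w ↦ 1 / w + ρ ^ 2 w`.
  set t : ℝ := 1 + 4 / ‖p‖ with ht
  have ht1 : 1 < t := by rw [ht]; linarith [show 0 < 4 / ‖p‖ by positivity]
  have htp : (t : ℂ) * p ∉ K := smul_notMem_of_starConvex hstar hp ht1.le
  have ht0 : (t : ℂ) ≠ 0 := by exact_mod_cast (by linarith : t ≠ 0)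
  have htc : (t : ℂ) - 1 ≠ 0 := by exact_mod_cast (sub_pos.2 ht1).ne'
  obtain ⟨a, ha, haz⟩ := exists_sqrt_mem_polyClosure hstar h0 hp
  obtain ⟨b, hb, hbz⟩ := exists_sqrt_mem_polyClosure hstar h0 htp
  set s : ℂ := Complex.exp (Complex.log t / 2) with hs
  have hs2 : s ^ 2 = t := exp_half_log_sq ht0
  -- With `A ^ 2 = 1 - z / p` and `B ^ 2 = t - z / p`, this makes `ρ g = -(B - A) / (B + A)`, a root
  -- of the Joukowski equation. The choice of branches gives `‖B - A‖ ≤ ‖B + A‖`, that is `‖ρ g‖ ≤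
  -- 1`.
  set g : C(K, ℂ) := (-4 / ((t - 1) ^ 2 * p) : ℂ) • (s • b - a) ^ 2 with hg
  set ρ : ℂ := (t - 1) / 4 * p with hρ
  have hnρ : ‖ρ‖ = 1 := by
    have : ((t : ℂ) - 1) = ((4 / ‖p‖ : ℝ) : ℂ) := by rw [ht]; push_cast; ring
    rw [hρ, this, norm_mul, norm_div, Complex.norm_real, Real.norm_of_nonneg (by positivity)]
    simp
    field_simp
  have key : ∀ z : K, ∃ A B : ℂ, A ^ 2 = 1 - z / p ∧ B ^ 2 = t - z / p ∧ ‖B - A‖ ≤ ‖B + A‖ ∧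
      g z = -4 / ((t - 1) ^ 2 * p) * (B - A) ^ 2 := by
    intro z
    have hA := one_sub_mul_div_ne_zero hstar h0 hp z (s := 1) (by simp)
    have hB := one_sub_div_mem_slitPlane hstar h0 htp z (s := 1) (by simp)
    simp only [Complex.ofReal_one, one_mul] at hA hB
    have hB0 := Complex.slitPlane_ne_zero hB
    have hmul : (t : ℂ) * (1 - z / (t * p)) = t - z / p := by field_simp
    have hBlog : s * b z = Complex.exp (Complex.log (t - z / p) / 2) := by
      rw [← hmul, Complex.log_ofReal_mul (by linarith) hB0, hbz, hs, ← Complex.exp_add,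
        Complex.ofReal_log (by linarith)]
      congr 1; ring
    refine ⟨a z, s * b z, ?_, ?_, ?_, ?_⟩
    · rw [haz, exp_half_log_sq hA]
    · rw [mul_pow, hs2, hbz, exp_half_log_sq hB0, hmul]
    · rw [haz, hBlog]
      -- The two radicands differ by a real number, so they lie in the same half plane.
      apply norm_exp_half_log_sub_le
      have h1 : (1 - (z : ℂ) / p).im = -((z : ℂ) / p).im := by simp
      have h2 : ((t : ℂ) - (z : ℂ) / p).im = -((z : ℂ) / p).im := by simp
      rw [h1, h2, and_self, and_self]
      exact le_or_gt _ _
    · simp [hg]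
  refine ⟨g, Subalgebra.smul_mem _ (pow_mem (sub_mem (Subalgebra.smul_mem _ hb _) ha) 2) _,
    p + 2 * ρ, ρ, by simp [hnρ], hnρ, fun z => ?_⟩
  obtain ⟨A, B, hA, hB, hAB, hgz⟩ := key z
  have hAB2 : (B - A) * (B + A) = t - 1 := by linear_combination hB - hA
  have hne : B + A ≠ 0 := right_ne_zero_of_mul (hAB2.trans_ne htc)
  have hρg : ρ * g z = - ((B - A) / (B + A)) := by
    rw [hgz, hρ, ← hAB2]
    have : B - A ≠ 0 := left_ne_zero_of_mul (hAB2.trans_ne htc)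
    field_simp
  constructor
  · have hz : (z : ℂ) - (p + 2 * ρ) = - p * (A ^ 2 + B ^ 2) / 2 := by
      rw [hA, hB, hρ]; field_simp; ring
    have hgz2 : g z = -4 / (p * (B + A) ^ 2) := by
      rw [hgz, ← hAB2]
      have : B - A ≠ 0 := left_ne_zero_of_mul (hAB2.trans_ne htc)
      field_simp
    rw [hz, ← mul_pow, hρg, hgz2]
    field_simp
    ring
  · rw [hρg, norm_neg, norm_div]
    exact div_le_one_of_le₀ hAB (norm_nonneg _)

/-- Multiplied by `u - η`, the difference becomes a combination of `g ^ 2` and `g ^ 3`, bounded by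
`(1 + 4 + 16) ‖g‖ ^ 2`. Since `‖g‖ ≤ 1` and `‖u - η‖ ‖g‖ ≤ 6`, one has `‖g‖ ^ 2 (1 + ‖u - η‖ ^ 2) ≤
37`, and `777 = 21 * 37`. -/
theorem norm_kernel_sub_inv_le {u g ρ η : ℂ} (hρ : ‖ρ‖ = 1) (hη : ‖η‖ ≤ 4) (hne : u ≠ η)
    (hg : u * g = 1 + ρ ^ 2 * g ^ 2) (hg1 : ‖ρ * g‖ ≤ 1) :
    ‖g + η * g ^ 2 - (u - η)⁻¹‖ ≤ 777 * (‖u - η‖ * (1 + ‖u - η‖ ^ 2))⁻¹ := by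
  set d := u - η with hd
  have hd0 : d ≠ 0 := sub_ne_zero.2 hne
  have hdn : 0 < ‖d‖ := norm_pos_iff.2 hd0
  have hgn : ‖g‖ ≤ 1 := by simpa [hρ] using hg1
  have h0 := norm_nonneg g
  have hug : ‖u * g‖ ≤ 2 := by
    rw [hg]
    refine (norm_add_le _ _).trans ?_
    simp only [norm_one, norm_mul, norm_pow, hρ]
    nlinarith
  have hdg : ‖d‖ * ‖g‖ ≤ 6 := by
    rw [← norm_mul, hd, sub_mul]
    refine (norm_sub_le _ _).trans ?_
    rw [norm_mul η]
    nlinarith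
  have hQ : d * (g + η * g ^ 2 - d⁻¹) = ρ ^ 2 * g ^ 2 + η * ρ ^ 2 * g ^ 3 - η ^ 2 * g ^ 2 := by
    rw [mul_sub, mul_inv_cancel₀ hd0, hd]
    linear_combination (1 + η * g) * hg
  have hQn : ‖d * (g + η * g ^ 2 - d⁻¹)‖ ≤ 21 * ‖g‖ ^ 2 := by
    rw [hQ]
    refine (norm_sub_le _ _).trans ((add_le_add (norm_add_le _ _) le_rfl).trans ?_)
    simp only [norm_mul, norm_pow, hρ]
    have h1 : ‖η‖ * ‖g‖ ^ 3 ≤ 4 * ‖g‖ ^ 2 := by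
      have : ‖g‖ ^ 3 ≤ ‖g‖ ^ 2 := pow_le_pow_of_le_one h0 hgn (by norm_num)
      exact mul_le_mul hη this (by positivity) (by norm_num)
    have h2 : ‖η‖ ^ 2 * ‖g‖ ^ 2 ≤ 16 * ‖g‖ ^ 2 := by
      have : ‖η‖ ^ 2 ≤ 4 ^ 2 := pow_le_pow_left₀ (norm_nonneg _) hη 2
      nlinarith [sq_nonneg ‖g‖]
    linarith
  have hg2 : ‖g‖ ^ 2 * (1 + ‖d‖ ^ 2) ≤ 37 := by
    have h1 : (‖d‖ * ‖g‖) ^ 2 ≤ 6 ^ 2 := pow_le_pow_left₀ (by positivity) hdg 2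
    have h2 : ‖g‖ ^ 2 ≤ 1 := pow_le_one₀ h0 hgn
    nlinarith
  rw [← div_eq_mul_inv, le_div_iff₀ (by positivity)]
  rw [norm_mul] at hQn
  nlinarith [mul_le_mul_of_nonneg_right hQn (show 0 ≤ 1 + ‖d‖ ^ 2 by positivity)]

/-! ### The Cauchy-Pompeiu formula and integrability of the Cauchy kernel. -/

/-- Integration in polar coordinates of a function which is continuous in these coordinates. -/
theorem integral_eq_intervalIntegral_polar {F : ℂ → ℂ} {G : ℝ × ℝ → ℂ} (hG : Continuous G)
    {R : ℝ} (hR : 0 ≤ R) (hF : ∀ r : ℝ, 0 < r → ∀ θ : ℝ, r * F (r * Complex.exp (θ * Complex.I)) = G (r, θ))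
    (hsupp : ∀ r > R, ∀ θ, G (r, θ) = 0) :
    ∫ z, F z = ∫ r in (0 : ℝ)..R, ∫ θ in -Real.pi..Real.pi, G (r, θ) := by
  have hpi : -Real.pi ≤ Real.pi := by linarith [Real.pi_pos]
  rw [← Complex.integral_comp_polarCoord_symm, polarCoord_target]
  have h1 : ∫ p in Set.Ioi (0 : ℝ) ×ˢ Set.Ioo (-Real.pi) Real.pi,
      p.1 • F (Complex.polarCoord.symm p) =
      ∫ p in Set.Ioi (0 : ℝ) ×ˢ Set.Ioo (-Real.pi) Real.pi, G p := by
    refine MeasureTheory.setIntegral_congr_fun (measurableSet_Ioi.prod measurableSet_Ioo) ?_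
    rintro ⟨r, θ⟩ hp
    rw [← hF r hp.1 θ, Complex.exp_mul_I]
    simp
  rw [h1]
  have h2 : ∫ p in Set.Ioi (0 : ℝ) ×ˢ Set.Ioo (-Real.pi) Real.pi, G p =
      ∫ p in Set.Ioc (0 : ℝ) R ×ˢ Set.Ioo (-Real.pi) Real.pi, G p := by
    refine MeasureTheory.setIntegral_eq_of_subset_of_forall_sdiff_eq_zero
      (measurableSet_Ioi.prod measurableSet_Ioo)
      (Set.prod_mono Set.Ioc_subset_Ioi_self le_rfl) ?_
    rintro ⟨r, θ⟩ ⟨hp, hp'⟩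
    refine hsupp r ?_ θ
    by_contra! hr
    exact hp' ⟨⟨hp.1, hr⟩, hp.2⟩
  rw [h2, MeasureTheory.Measure.volume_eq_prod, MeasureTheory.setIntegral_prod,
    intervalIntegral.integral_of_le hR]
  · refine MeasureTheory.setIntegral_congr_fun measurableSet_Ioc fun r _ => ?_
    rw [intervalIntegral.integral_of_le hpi, MeasureTheory.integral_Ioc_eq_integral_Ioo]
  · rw [← MeasureTheory.Measure.volume_eq_prod]
    exact (hG.continuousOn.integrableOn_compact
      ((isCompact_Icc (a := (0 : ℝ)) (b := R)).prod
        (isCompact_Icc (a := -Real.pi) (b := Real.pi)))).mono_set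
      (Set.prod_mono Set.Ioc_subset_Icc_self Set.Ioo_subset_Icc_self)

/-- Twice the operator `∂/∂z̄`. -/
noncomputable def wirtinger (Φ : ℂ → ℂ) (z : ℂ) : ℂ :=
  fderiv ℝ Φ z 1 + Complex.I * fderiv ℝ Φ z Complex.I

theorem continuous_wirtinger {Φ : ℂ → ℂ} (hΦ : ContDiff ℝ 1 Φ) : Continuous (wirtinger Φ) := by
  have := hΦ.continuous_fderiv one_ne_zero
  unfold wirtinger
  fun_prop

theorem hasCompactSupport_wirtinger {Φ : ℂ → ℂ} (hΦ : HasCompactSupport Φ) :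
    HasCompactSupport (wirtinger Φ) := by
  refine (hΦ.fderiv (𝕜 := ℝ)).mono fun z hz => ?_
  contrapose! hz
  simp only [Function.mem_support, not_not] at hz ⊢
  simp [wirtinger, hz]

/-- The operator `∂/∂x + i ∂/∂y` in the rotated frame of radial and tangential directions. -/
theorem clm_exp_add (A : ℂ →L[ℝ] ℂ) (θ : ℝ) :
    (A 1 + Complex.I * A Complex.I) = Complex.exp (θ * Complex.I) *
      (A (Complex.exp (θ * Complex.I)) +
        Complex.I * A (Complex.I * Complex.exp (θ * Complex.I))) := by
  have h1 : Complex.exp (θ * Complex.I) = Real.cos θ • (1 : ℂ) + Real.sin θ • Complex.I := by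
    rw [Complex.exp_mul_I]; simp
  have h2 : Complex.I * Complex.exp (θ * Complex.I) =
      -Real.sin θ • (1 : ℂ) + Real.cos θ • Complex.I := by
    rw [Complex.exp_mul_I]
    simp only [neg_smul, Complex.real_smul, Complex.ofReal_cos, Complex.ofReal_sin]
    linear_combination Complex.sin θ * Complex.I_mul_I
  have hcs : (Complex.cos θ) ^ 2 + Complex.sin θ ^ 2 = 1 := Complex.cos_sq_add_sin_sq _
  rw [h2, h1]
  simp only [map_add, map_smul]
  simp only [Complex.real_smul, Complex.ofReal_neg, mul_one,
    Complex.ofReal_cos, Complex.ofReal_sin]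
  linear_combination (-A 1 - Complex.I * A Complex.I) * hcs
    + (A 1 * Complex.sin θ ^ 2 - A Complex.I * Complex.cos θ * Complex.sin θ) * Complex.I_mul_I

theorem hasDerivAt_ray (z : ℂ) (θ r : ℝ) :
    HasDerivAt (fun r : ℝ => z + r * Complex.exp (θ * Complex.I))
      (Complex.exp (θ * Complex.I)) r := by
  simpa using ((Complex.ofRealCLM.hasDerivAt (x := r)).mul_const
    (Complex.exp (θ * Complex.I))).const_add z

/-- The Cauchy-Pompeiu formula for compactly supported functions. -/
theorem integral_wirtinger_mul_inv {Φ : ℂ → ℂ} (hΦ : ContDiff ℝ 1 Φ) (hsupp : HasCompactSupport Φ)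
    (z : ℂ) : ∫ ζ, wirtinger Φ ζ * (z - ζ)⁻¹ = 2 * Real.pi * Φ z := by
  have hdiff : Differentiable ℝ Φ := hΦ.differentiable one_ne_zero
  have hcont : Continuous (fderiv ℝ Φ) := hΦ.continuous_fderiv one_ne_zero
  obtain ⟨R, hR⟩ : ∃ R : ℝ, ∀ ζ, R < ‖ζ‖ → Φ (z + ζ) = 0 ∧ fderiv ℝ Φ (z + ζ) = 0 := by
    have hc : IsCompact (tsupport Φ) := hsupp
    obtain ⟨C, hC⟩ := hc.isBounded.exists_norm_le
    have hout : ∀ ζ, C + ‖z‖ < ‖ζ‖ → z + ζ ∉ tsupport Φ := by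
      intro ζ hζ hmem
      have h1 := hC _ hmem
      have h2 : ‖ζ‖ ≤ ‖z + ζ‖ + ‖z‖ := by simpa using norm_sub_le (z + ζ) z
      linarith
    refine ⟨C + ‖z‖, fun ζ hζ => ⟨image_eq_zero_of_notMem_tsupport (hout ζ hζ), ?_⟩⟩
    exact image_eq_zero_of_notMem_tsupport fun h => hout ζ hζ (tsupport_fderiv_subset ℝ h)
  set R' : ℝ := max R 0 + 1 with hR'
  have hR'0 : 0 ≤ R' := by positivity
  have hRR' : R < R' := lt_of_le_of_lt (le_max_left _ _) (lt_add_one _)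
  set e : ℝ → ℂ := fun θ => Complex.exp (θ * Complex.I) with he
  have hecont : Continuous e := by fun_prop
  have henorm : ∀ θ, ‖e θ‖ = 1 := fun θ => Complex.norm_exp_ofReal_mul_I θ
  set D : ℝ × ℝ → ℂ →L[ℝ] ℂ := fun p => fderiv ℝ Φ (z + p.1 * e p.2) with hD
  have hDcont : Continuous D := hcont.comp (by fun_prop)
  set G₁ : ℝ × ℝ → ℂ := fun p => D p (e p.2) with hG₁
  set G₂ : ℝ × ℝ → ℂ := fun p => D p (Complex.I * e p.2) with hG₂
  have hG₁c : Continuous G₁ := hDcont.clm_apply (by fun_prop)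
  have hG₂c : Continuous G₂ := hDcont.clm_apply (by fun_prop)
  have hray : ∀ r θ : ℝ, R < r → Φ (z + r * e θ) = 0 ∧ fderiv ℝ Φ (z + r * e θ) = 0 := by
    intro r θ hr
    apply hR
    rw [norm_mul, henorm, mul_one, Complex.norm_real]
    exact hr.trans_le (le_abs_self r)
  have htrans : ∫ ζ, wirtinger Φ ζ * (z - ζ)⁻¹ = ∫ ζ, wirtinger Φ (z + ζ) * (-ζ)⁻¹ := by
    rw [← MeasureTheory.integral_add_left_eq_self _ z]
    simp
  rw [htrans, integral_eq_intervalIntegral_polar (G := fun p => -G₁ p - Complex.I * G₂ p)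
    (by fun_prop) hR'0]
  rotate_left
  · intro r hr θ
    have hr0 : (r : ℂ) ≠ 0 := by exact_mod_cast hr.ne'
    rw [wirtinger, clm_exp_add _ θ]
    simp only [hG₁, hG₂, hD, he]
    have := Complex.exp_ne_zero (θ * Complex.I)
    field_simp
    ring
  · intro r hr θ
    simp [hG₁, hG₂, hD, (hray r θ (hRR'.trans hr)).2]
  -- The tangential part is the derivative of a periodic function on each circle. The radial part
  -- integrates along rays to `-Φ z`.
  have hθ : ∀ r ∈ Set.uIcc 0 R', r ≠ 0 → ∫ θ in -Real.pi..Real.pi, G₂ (r, θ) = 0 := by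
    intro r _ hr
    have hr0 : (r : ℂ) ≠ 0 := by exact_mod_cast hr
    have hd : ∀ θ ∈ Set.uIcc (-Real.pi) Real.pi,
        HasDerivAt (fun θ : ℝ => Φ (circleMap z r θ)) (r * G₂ (r, θ)) θ := by
      intro θ _
      have h1 := (hdiff (circleMap z r θ)).hasFDerivAt.comp_hasDerivAt θ (hasDerivAt_circleMap z r θ)
      refine h1.congr_deriv ?_
      rw [circleMap_zero]
      simp only [hG₂, hD, he]
      rw [show (r : ℂ) * Complex.exp (θ * Complex.I) * Complex.I =
        r • (Complex.I * Complex.exp (θ * Complex.I)) by rw [Complex.real_smul]; ring, map_smul,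
        Complex.real_smul]
      rfl
    have h2 := intervalIntegral.integral_eq_sub_of_hasDerivAt hd
      (Continuous.intervalIntegrable (by fun_prop) _ _)
    rw [intervalIntegral.integral_const_mul] at h2
    have h3 : circleMap z r Real.pi = circleMap z r (-Real.pi) := by simp [circleMap]
    simp only [h3, sub_self] at h2
    exact (mul_eq_zero.1 h2).resolve_left hr0
  have hr : ∀ θ, ∫ r in (0 : ℝ)..R', G₁ (r, θ) = - Φ z := by
    intro θ
    rw [intervalIntegral.integral_eq_sub_of_hasDerivAt
      (f := fun r : ℝ => Φ (z + r * e θ))]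
    · simp [(hray R' θ hRR').1]
    · intro r _
      exact (hdiff _).hasFDerivAt.comp_hasDerivAt r (hasDerivAt_ray z θ r)
    · exact Continuous.intervalIntegrable (by fun_prop) _ _
  calc ∫ r in (0 : ℝ)..R', ∫ θ in -Real.pi..Real.pi, (-G₁ (r, θ) - Complex.I * G₂ (r, θ))
      = ∫ r in (0 : ℝ)..R', ∫ θ in -Real.pi..Real.pi, -G₁ (r, θ) := by
        refine intervalIntegral.integral_congr_ae ?_
        refine (MeasureTheory.Measure.ae_ne MeasureTheory.volume (0 : ℝ)).mono fun r hr hmem => ?_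
        rw [intervalIntegral.integral_sub (Continuous.intervalIntegrable (by fun_prop) _ _)
          (Continuous.intervalIntegrable (by fun_prop) _ _), intervalIntegral.integral_const_mul,
          hθ r (Set.uIoc_subset_uIcc hmem) hr]
        simp
    _ = ∫ θ in -Real.pi..Real.pi, ∫ r in (0 : ℝ)..R', -G₁ (r, θ) := by
        apply MeasureTheory.intervalIntegral_intervalIntegral_swap
          (F := fun r θ => -G₁ (r, θ))
        exact ((hG₁c.neg.continuousOn.integrableOn_compact
          ((isCompact_uIcc (a := (0 : ℝ)) (b := R')).prod
            (isCompact_uIcc (a := -Real.pi) (b := Real.pi)))).mono_set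
          (Set.prod_mono Set.uIoc_subset_uIcc Set.uIoc_subset_uIcc))
    _ = 2 * Real.pi * Φ z := by
        simp only [intervalIntegral.integral_neg, hr, neg_neg]
        rw [intervalIntegral.integral_const]
        simp only [Complex.real_smul]
        push_cast
        ring

/-- The radial kernel `1 / (|z| (1 + |z|²))`. -/
theorem integrable_radial_kernel :
    MeasureTheory.Integrable (fun ζ : ℂ => (‖ζ‖ * (1 + ‖ζ‖ ^ 2))⁻¹) := by
  rw [MeasureTheory.integrable_fun_norm_addHaar MeasureTheory.volume
    (f := fun r : ℝ => (r * (1 + r ^ 2))⁻¹), Complex.finrank_real_complex]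
  refine integrable_inv_one_add_sq.integrableOn.congr_fun ?_ measurableSet_Ioi
  intro r hr
  have : r ≠ 0 := (Set.mem_Ioi.1 hr).ne'
  simp
  field_simp

theorem integrable_mul_inv_sub {h : ℂ → ℂ} (hc : Continuous h) (hs : HasCompactSupport h) (z : ℂ) :
    MeasureTheory.Integrable (fun ζ => h ζ * (z - ζ)⁻¹) := by
  -- The extra factor is harmless on a compact support, and turns the bound on `h` into domination
  -- by the radial kernel.
  have hcc : HasCompactSupport (fun ζ => h ζ * ((1 + ‖z - ζ‖ ^ 2 : ℝ) : ℂ)) := hs.mul_right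
  obtain ⟨C, hC⟩ := hcc.exists_bound_of_continuous (by fun_prop)
  refine ((integrable_radial_kernel.comp_sub_left z).const_mul C).mono' ?_ (.of_forall fun ζ => ?_)
  · exact (hc.measurable.mul (by fun_prop)).aestronglyMeasurable
  · have h1 := hC ζ
    rw [norm_mul, Complex.norm_real, Real.norm_of_nonneg (by positivity)] at h1
    rw [norm_mul, norm_inv, mul_inv, mul_comm ‖z - ζ‖⁻¹, ← mul_assoc]
    refine mul_le_mul_of_nonneg_right ?_ (by positivity)
    rw [← div_eq_mul_inv, le_div_iff₀ (by positivity)]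
    exact h1

/-! ### Mollification at scale one. -/

/-- A radial mollifier supported in the unit disc. -/
theorem exists_radial_mollifier : ∃ (A : ℂ → ℂ) (b : ℝ → ℝ), ContDiff ℝ 1 A ∧
    (∀ ζ, 1 ≤ ‖ζ‖ → A ζ = 0) ∧ HasCompactSupport A ∧ ∫ ζ, A ζ = 1 ∧ ∫ ζ, ‖A ζ‖ = 1 ∧
    Continuous b ∧ (∀ r, 1 < r → b r = 0) ∧ ∀ ζ, wirtinger A ζ = b ‖ζ‖ * ζ := by
  set ψ : ℂ → ℝ := fun ζ => Real.smoothTransition (1 - ‖ζ‖ ^ 2) with hψ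
  have hst : ContDiff ℝ 1 Real.smoothTransition := Real.smoothTransition.contDiff (n := 1)
  have hψs : ContDiff ℝ 1 ψ := hst.comp (contDiff_const.sub (contDiff_norm_sq ℝ))
  have hψ0 : ∀ ζ, 1 ≤ ‖ζ‖ → ψ ζ = 0 := fun ζ hζ =>
    Real.smoothTransition.zero_of_nonpos (by nlinarith)
  have hψnn : ∀ ζ, 0 ≤ ψ ζ := fun ζ => Real.smoothTransition.nonneg _
  have hψc : HasCompactSupport ψ := by
    refine HasCompactSupport.intro (isCompact_closedBall (0 : ℂ) 1) fun ζ hζ => hψ0 ζ ?_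
    rw [mem_closedBall_zero_iff, not_le] at hζ
    exact hζ.le
  have hm : 0 < ∫ ζ, ψ ζ := by
    refine hψs.continuous.integral_pos_of_hasCompactSupport_nonneg_nonzero hψc hψnn (x := 0) ?_
    simp [hψ]
  set m : ℝ := ∫ ζ, ψ ζ with hmdef
  have hderiv : ∀ ζ, HasFDerivAt (fun ζ => ((m⁻¹ * ψ ζ : ℝ) : ℂ)) (Complex.ofRealCLM.comp
      (m⁻¹ • (deriv Real.smoothTransition (1 - ‖ζ‖ ^ 2) • -(2 • innerSL ℝ ζ)))) ζ := by
    intro ζ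
    have h1 : HasFDerivAt (fun ζ : ℂ => 1 - ‖ζ‖ ^ 2) (-(2 • innerSL ℝ ζ)) ζ :=
      (hasStrictFDerivAt_norm_sq ζ).hasFDerivAt.const_sub 1
    have h2 : HasDerivAt Real.smoothTransition (deriv Real.smoothTransition (1 - ‖ζ‖ ^ 2))
      ((fun ζ : ℂ => 1 - ‖ζ‖ ^ 2) ζ) := (hst.differentiable one_ne_zero _).hasDerivAt
    have h3 := (h2.comp_hasFDerivAt ζ h1).const_mul m⁻¹
    exact Complex.ofRealCLM.hasFDerivAt.comp ζ h3
  refine ⟨fun ζ => ((m⁻¹ * ψ ζ : ℝ) : ℂ),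
    fun r => m⁻¹ * (deriv Real.smoothTransition (1 - r ^ 2) * -2), ?_, ?_, ?_, ?_, ?_, ?_, ?_, ?_⟩
  · exact Complex.ofRealCLM.contDiff.comp (contDiff_const.mul hψs)
  · intro ζ hζ
    simp [hψ0 ζ hζ]
  · exact hψc.mono fun ζ hζ => by
      contrapose! hζ
      simp only [Function.mem_support, not_not] at hζ ⊢
      simp [hζ]
  · rw [integral_complex_ofReal, MeasureTheory.integral_const_mul, ← hmdef,
      inv_mul_cancel₀ hm.ne', Complex.ofReal_one]
  · simp_rw [Complex.norm_real, Real.norm_eq_abs,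
      fun ζ => abs_of_nonneg (mul_nonneg (inv_nonneg.2 hm.le) (hψnn ζ))]
    rw [MeasureTheory.integral_const_mul, ← hmdef, inv_mul_cancel₀ hm.ne']
  · have := hst.continuous_deriv le_rfl
    fun_prop
  · intro r hr
    have : deriv Real.smoothTransition (1 - r ^ 2) = 0 := by
      have h1 : Real.smoothTransition =ᶠ[𝓝 (1 - r ^ 2)] fun _ => 0 := by
        filter_upwards [Iio_mem_nhds (show 1 - r ^ 2 < 0 by nlinarith)] with x hx
        exact Real.smoothTransition.zero_of_nonpos (le_of_lt hx)
      rw [h1.deriv_eq, deriv_const]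
    simp [this]
  · intro ζ
    rw [wirtinger, (hderiv ζ).fderiv]
    have hz : (ζ : ℂ) = ζ.re + ζ.im * Complex.I := (Complex.re_add_im ζ).symm
    simp only [ContinuousLinearMap.comp_apply, smul_apply,
      neg_apply, innerSL_apply_apply, Complex.inner, Complex.ofRealCLM_apply,
      smul_eq_mul, Complex.conj_re, Complex.mul_re, Complex.conj_im, Complex.I_re, Complex.I_im]
    push_cast
    simp
    linear_combination
      (2 * (m : ℂ)⁻¹ * (deriv Real.smoothTransition (1 - ‖ζ‖ ^ 2) : ℝ)) * hz

theorem integral_circle_eq_zero {f : ℂ → ℂ} {z : ℂ} (hf : DifferentiableOn ℂ f (Metric.ball z 1))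
    {r : ℝ} (hr0 : 0 < r) (hr : r < 1) :
    ∫ θ in -Real.pi..Real.pi, f (z - r * Complex.exp (θ * Complex.I)) *
      Complex.exp (θ * Complex.I) = 0 := by
  have hr0' : (r : ℂ) ≠ 0 := by exact_mod_cast hr0.ne'
  have hd : ∀ w ∈ Metric.closedBall (0 : ℂ) r, DifferentiableAt ℂ (fun w => f (z - w)) w := by
    intro w hw
    have h1 : z - w ∈ Metric.ball z 1 := by
      rw [mem_closedBall_zero_iff] at hw
      simpa using hw.trans_lt hr
    exact (hf.differentiableAt (Metric.isOpen_ball.mem_nhds h1)).comp w (by fun_prop)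
  have h := Complex.circleIntegral_eq_zero_of_differentiable_on_off_countable hr0.le
    Set.countable_empty (fun w hw => (hd w hw).continuousAt.continuousWithinAt)
    (fun w hw => hd w (Metric.ball_subset_closedBall hw.1))
  rw [circleIntegral] at h
  set G : ℝ → ℂ := fun θ => f (z - r * Complex.exp (θ * Complex.I)) * Complex.exp (θ * Complex.I)
    with hG
  have hper : Function.Periodic G (2 * Real.pi) := by
    intro θ
    have : Complex.exp (((θ + 2 * Real.pi : ℝ) : ℂ) * Complex.I) = Complex.exp (θ * Complex.I) := by
      push_cast
      rw [add_mul, Complex.exp_periodic]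
    simp only [hG, this]
  have h2 := hper.intervalIntegral_add_eq (-Real.pi) 0
  rw [show -Real.pi + 2 * Real.pi = Real.pi by ring, zero_add] at h2
  rw [h2]
  have h3 : ∀ θ : ℝ, deriv (circleMap 0 r) θ • f (z - circleMap 0 r θ) =
      (r * Complex.I) * G θ := by
    intro θ
    simp only [deriv_circleMap, circleMap_zero, hG, smul_eq_mul]
    ring
  simp_rw [h3] at h
  rw [intervalIntegral.integral_const_mul] at h
  exact (mul_eq_zero.1 h).resolve_left (mul_ne_zero hr0' Complex.I_ne_zero)

/-- Used with `k` the mollifier, of integral one, to bound `Φ - f`, and with `k` its `∂/∂z̄`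
derivative, of integral zero, to bound that of `Φ`. -/
theorem norm_average_sub_le {f k : ℂ → ℂ} {ω : ℝ} (hf : Continuous f)
    (hω : ∀ x y, ‖x - y‖ ≤ 1 → ‖f x - f y‖ ≤ ω) (hk : Continuous k) (hks : HasCompactSupport k)
    (hk0 : ∀ ζ, 1 < ‖ζ‖ → k ζ = 0) (z : ℂ) :
    ‖(∫ t, f (z - t) * k t) - f z * ∫ t, k t‖ ≤ (∫ t, ‖k t‖) * ω := by
  have hi1 : MeasureTheory.Integrable fun t => f (z - t) * k t :=
    Continuous.integrable_of_hasCompactSupport (by fun_prop) hks.mul_left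
  have hi2 : MeasureTheory.Integrable fun t => f z * k t :=
    Continuous.integrable_of_hasCompactSupport (by fun_prop) hks.mul_left
  rw [← MeasureTheory.integral_const_mul, ← MeasureTheory.integral_sub hi1 hi2, ← MeasureTheory.integral_mul_const]
  refine MeasureTheory.norm_integral_le_of_norm_le
    ((hk.norm.integrable_of_hasCompactSupport hks.norm).mul_const ω) (.of_forall fun t => ?_)
  rw [← sub_mul, norm_mul, mul_comm]
  rcases le_or_gt ‖t‖ 1 with ht | ht
  · exact mul_le_mul_of_nonneg_left (hω _ _ (by simpa using ht)) (norm_nonneg _)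
  · simp [hk0 t ht]

/-- The integral `∫ f (z - t) A t` as a function of `z`. -/
noncomputable def mollify (f A : ℂ → ℂ) : ℂ → ℂ :=
  MeasureTheory.convolution f A (ContinuousLinearMap.mul ℝ ℂ) MeasureTheory.volume

theorem mollify_apply (f A : ℂ → ℂ) (z : ℂ) : mollify f A z = ∫ t, f (z - t) * A t :=
  MeasureTheory.convolution_eq_swap _

theorem contDiff_mollify {f A : ℂ → ℂ} (hf : Continuous f) (hA : ContDiff ℝ 1 A)
    (hAc : HasCompactSupport A) : ContDiff ℝ 1 (mollify f A) :=
  hAc.contDiff_convolution_right (n := 1) (ContinuousLinearMap.mul ℝ ℂ)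
    (hf.locallyIntegrable (μ := MeasureTheory.volume)) hA

theorem hasCompactSupport_mollify {f A : ℂ → ℂ} (hf : HasCompactSupport f)
    (hA : HasCompactSupport A) : HasCompactSupport (mollify f A) :=
  hf.convolution (ContinuousLinearMap.mul ℝ ℂ) hA

theorem fderiv_mollify {f A : ℂ → ℂ} (hf : Continuous f) (hA : ContDiff ℝ 1 A)
    (hAc : HasCompactSupport A) (z v : ℂ) :
    fderiv ℝ (mollify f A) z v = ∫ t, f (z - t) * fderiv ℝ A t v := by
  have h1 := (hAc.hasFDerivAt_convolution_right (ContinuousLinearMap.mul ℝ ℂ)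
    (hf.locallyIntegrable (μ := MeasureTheory.volume)) hA z).fderiv
  rw [mollify, h1, MeasureTheory.convolution_precompR_apply _ hf.locallyIntegrable
    (hAc.fderiv (𝕜 := ℝ)) (hA.continuous_fderiv one_ne_zero), MeasureTheory.convolution_eq_swap]
  simp only [ContinuousLinearMap.mul_apply']

/-- All derivatives fall on `A`, since `f` is only continuous. -/
theorem wirtinger_mollify {f A : ℂ → ℂ} (hf : Continuous f) (hA : ContDiff ℝ 1 A)
    (hAc : HasCompactSupport A) (z : ℂ) :
    wirtinger (mollify f A) z = ∫ t, f (z - t) * wirtinger A t := by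
  have hfd : Continuous (fderiv ℝ A) := hA.continuous_fderiv one_ne_zero
  have hi : ∀ v, MeasureTheory.Integrable fun t => f (z - t) * fderiv ℝ A t v := by
    intro v
    have hs : HasCompactSupport fun t => fderiv ℝ A t v :=
      (hAc.fderiv (𝕜 := ℝ)).mono fun t ht => by
        contrapose! ht
        simp only [Function.mem_support, not_not] at ht ⊢
        simp [ht]
    exact Continuous.integrable_of_hasCompactSupport (by fun_prop) hs.mul_left
  rw [wirtinger, fderiv_mollify hf hA hAc, fderiv_mollify hf hA hAc,
    ← MeasureTheory.integral_const_mul,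
    ← MeasureTheory.integral_add (hi 1) ((hi Complex.I).const_mul _)]
  congr 1
  ext t
  rw [wirtinger]
  ring

/-- Mollification of a continuous function at scale one. -/
theorem exists_mollification : ∃ M : ℝ, 0 ≤ M ∧ ∀ (f : ℂ → ℂ) (ω : ℝ), Continuous f →
    HasCompactSupport f → (∀ x y, ‖x - y‖ ≤ 1 → ‖f x - f y‖ ≤ ω) →
    ∃ Φ : ℂ → ℂ, ContDiff ℝ 1 Φ ∧ HasCompactSupport Φ ∧ (∀ z, ‖Φ z - f z‖ ≤ ω) ∧
      (∀ z, ‖wirtinger Φ z‖ ≤ M * ω) ∧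
      ∀ z, DifferentiableOn ℂ f (Metric.ball z 1) → wirtinger Φ z = 0 := by
  obtain ⟨A, b, hA, hA0, hAc, hAint, hAnorm, hb, hb0, hW⟩ := exists_radial_mollifier
  have hWc : Continuous (wirtinger A) := continuous_wirtinger hA
  have hWs : HasCompactSupport (wirtinger A) := hasCompactSupport_wirtinger hAc
  have hW0 : ∀ ζ, 1 < ‖ζ‖ → wirtinger A ζ = 0 := fun ζ hζ => by simp [hW, hb0 _ hζ]
  -- The integrand is odd because the mollifier is radial.
  have hWint : ∫ ζ, wirtinger A ζ = 0 := by
    have h1 := MeasureTheory.integral_neg_eq_self (wirtinger A) MeasureTheory.volume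
    simp only [hW, norm_neg, mul_neg, MeasureTheory.integral_neg] at h1
    simp only [hW]
    exact CharZero.neg_eq_self_iff.1 h1
  refine ⟨∫ ζ, ‖wirtinger A ζ‖, MeasureTheory.integral_nonneg fun _ => norm_nonneg _,
    fun f ω hf hfs hω => ?_⟩
  refine ⟨mollify f A, contDiff_mollify hf hA hAc, hasCompactSupport_mollify hfs hAc, fun z => ?_, fun z => ?_, fun z hz => ?_⟩
  · have h1 := norm_average_sub_le hf hω hA.continuous hAc (fun ζ hζ => hA0 ζ hζ.le) z
    rwa [← mollify_apply, hAint, mul_one, hAnorm, one_mul] at h1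
  · have h1 := norm_average_sub_le hf hω hWc hWs hW0 z
    rwa [← wirtinger_mollify hf hA hAc, hWint, mul_zero, sub_zero] at h1
  -- Since `wirtinger A ζ` is a radial factor times `ζ`, the integral over each circle of radius
  -- below one is zero by Cauchy's theorem.
  · rw [wirtinger_mollify hf hA hAc, integral_eq_intervalIntegral_polar (R := 1) (G := fun p =>
      (p.1 ^ 2 * b p.1 : ℝ) * (f (z - p.1 * Complex.exp (p.2 * Complex.I)) *
        Complex.exp (p.2 * Complex.I))) (by fun_prop) zero_le_one]
    · refine (intervalIntegral.integral_congr_ae (g := fun _ => 0) ?_).trans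
        intervalIntegral.integral_zero
      refine (MeasureTheory.Measure.ae_ne MeasureTheory.volume (1 : ℝ)).mono fun r hr hmem => ?_
      rw [Set.uIoc_of_le zero_le_one] at hmem
      simp only
      rw [intervalIntegral.integral_const_mul,
        integral_circle_eq_zero hz hmem.1 (lt_of_le_of_ne hmem.2 hr), mul_zero]
    · intro r hr θ
      rw [hW, norm_mul, Complex.norm_exp_ofReal_mul_I, mul_one, Complex.norm_real,
        Real.norm_of_nonneg hr.le]
      push_cast
      ring
    · intro r hr θ
      simp [hb0 r hr]

/-! ### Approximation of Cauchy transforms and Mergelyan's theorem. -/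

/-- A compactly supported `h` whose support is close to the complement of the starlike compact
set `K` has a Cauchy transform which is close to the closure of the polynomials. -/
theorem exists_mem_polyClosure_near_cauchyTransform {K : Set ℂ} [CompactSpace K]
    (hstar : StarConvex ℝ (0 : ℂ) K) (h0 : (0 : ℂ) ∈ K) {h : ℂ → ℂ} (hc : Continuous h)
    (hs : HasCompactSupport h) {M : ℝ} (hM : ∀ ζ, ‖h ζ‖ ≤ M)
    (hnear : ∀ ζ ∈ tsupport h, ∃ p ∉ K, ‖ζ - p‖ < 2) :
    ∃ F ∈ polyClosure K, ∀ z : K, ‖(∫ ζ, h ζ * ((z : ℂ) - ζ)⁻¹) - F z‖ ≤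
      777 * M * ∫ ζ : ℂ, (‖ζ‖ * (1 + ‖ζ‖ ^ 2))⁻¹ := by
  have hM0 : 0 ≤ M := (norm_nonneg _).trans (hM 0)
  obtain ⟨n, p, hpK, hcov⟩ : ∃ (n : ℕ) (p : Fin n → ℂ), (∀ i, p i ∉ K) ∧
      tsupport h ⊆ ⋃ i, Metric.ball (p i) 2 := by
    obtain ⟨t, ht⟩ := IsCompact.elim_finite_subcover (ι := {p // p ∉ K}) hs
      (fun p => Metric.ball (p : ℂ) 2) (fun _ => Metric.isOpen_ball) (by
        intro ζ hζ
        obtain ⟨p, hp, hd⟩ := hnear ζ hζ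
        exact Set.mem_iUnion.2 ⟨⟨p, hp⟩, by simpa [dist_eq_norm] using hd⟩)
    refine ⟨t.card, fun i => (t.equivFin.symm i : {p // p ∉ K}), fun i => ?_, fun ζ hζ => ?_⟩
    · exact (t.equivFin.symm i : {p // p ∉ K}).2
    · obtain ⟨p, hp⟩ := Set.mem_iUnion.1 (ht hζ)
      obtain ⟨hpt, hp⟩ := Set.mem_iUnion.1 hp
      exact Set.mem_iUnion.2 ⟨t.equivFin ⟨p, hpt⟩, by simpa using hp⟩
  choose g hg c ρ hcp hρ hker using fun i => exists_segment_kernel hstar h0 (hpK i)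
  obtain ⟨χ, hχs, hχ1, hχ01, -⟩ := exists_continuous_sum_one_of_isOpen_isCompact
    (fun i => Metric.isOpen_ball (x := p i) (ε := 2)) hs hcov
  have hsum : ∀ ζ, h ζ = ∑ i, (χ i ζ : ℂ) * h ζ := by
    intro ζ
    rw [← Finset.sum_mul]
    by_cases hζ : ζ ∈ tsupport h
    · have h1 := hχ1 hζ
      rw [Finset.sum_apply, Pi.one_apply] at h1
      rw [← Complex.ofReal_sum, h1, Complex.ofReal_one, one_mul]
    · rw [image_eq_zero_of_notMem_tsupport hζ, mul_zero]
  have hχc : ∀ i, Continuous (χ i) := fun i => (χ i).continuous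
  have hhs : ∀ i, HasCompactSupport fun ζ => (χ i ζ : ℂ) * h ζ := fun i => hs.mul_left
  have hi1 : ∀ i, MeasureTheory.Integrable fun ζ => (χ i ζ : ℂ) * h ζ := fun i =>
    Continuous.integrable_of_hasCompactSupport (by fun_prop) (hhs i)
  have hi2 : ∀ i, MeasureTheory.Integrable fun ζ => (χ i ζ : ℂ) * h ζ * (ζ - c i) := fun i =>
    Continuous.integrable_of_hasCompactSupport (by fun_prop) (hhs i).mul_right
  have hi3 : ∀ i (z : ℂ), MeasureTheory.Integrable fun ζ => (χ i ζ : ℂ) * h ζ * (z - ζ)⁻¹ :=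
    fun i z => integrable_mul_inv_sub (by fun_prop) (hhs i) z
  -- A partition of unity cuts `h` into pieces near the `p i`. On each piece `1/(z - ζ)` is replaced
  -- by `g i + (ζ - c i) g i ^ 2`, whose integral against the piece is a combination of `g i` and `g
  -- i ^ 2`.
  refine ⟨∑ i, ((∫ ζ, (χ i ζ : ℂ) * h ζ) • g i + (∫ ζ, (χ i ζ : ℂ) * h ζ * (ζ - c i)) • g i ^ 2),
    sum_mem fun i _ => add_mem (Subalgebra.smul_mem _ (hg i) _)
      (Subalgebra.smul_mem _ (pow_mem (hg i) 2) _), fun z => ?_⟩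
  have hdiff : (∫ ζ, h ζ * ((z : ℂ) - ζ)⁻¹) - (∑ i, ((∫ ζ, (χ i ζ : ℂ) * h ζ) • g i +
      (∫ ζ, (χ i ζ : ℂ) * h ζ * (ζ - c i)) • g i ^ 2) : C(K, ℂ)) z =
      ∫ ζ, ∑ i, (χ i ζ : ℂ) * h ζ * (((z : ℂ) - ζ)⁻¹ - (g i z + (ζ - c i) * g i z ^ 2)) := by
    have hterm : ∀ i, MeasureTheory.Integrable fun ζ =>
        (χ i ζ : ℂ) * h ζ * (((z : ℂ) - ζ)⁻¹ - (g i z + (ζ - c i) * g i z ^ 2)) := by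
      intro i
      convert (hi3 i z).sub (((hi1 i).mul_const (g i z)).add ((hi2 i).mul_const (g i z ^ 2))) using 1
      ext ζ
      simp only [Pi.sub_apply, Pi.add_apply]
      ring
    have hfirst : ∀ ζ, h ζ * ((z : ℂ) - ζ)⁻¹ = ∑ i, (χ i ζ : ℂ) * h ζ * ((z : ℂ) - ζ)⁻¹ := by
      intro ζ
      rw [← Finset.sum_mul, ← hsum]
    rw [MeasureTheory.integral_finsetSum _ fun i _ => hterm i,
      MeasureTheory.integral_congr_ae (.of_forall hfirst),
      MeasureTheory.integral_finsetSum _ fun i _ => hi3 i z, ContinuousMap.sum_apply,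
      ← Finset.sum_sub_distrib]
    refine Finset.sum_congr rfl fun i _ => ?_
    simp only [ContinuousMap.add_apply, ContinuousMap.smul_apply, ContinuousMap.pow_apply,
      smul_eq_mul]
    rw [← MeasureTheory.integral_mul_const, ← MeasureTheory.integral_mul_const,
      ← MeasureTheory.integral_add ((hi1 i).mul_const _) ((hi2 i).mul_const _),
      ← MeasureTheory.integral_sub (hi3 i z)
        (by exact ((hi1 i).mul_const _).add ((hi2 i).mul_const _))]
    congr 1
    ext ζ
    ring
  rw [hdiff, ← MeasureTheory.integral_sub_left_eq_self
      (fun ζ : ℂ => (‖ζ‖ * (1 + ‖ζ‖ ^ 2))⁻¹) MeasureTheory.volume (z : ℂ),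
    ← MeasureTheory.integral_const_mul]
  refine MeasureTheory.norm_integral_le_of_norm_le
    ((integrable_radial_kernel.comp_sub_left (z : ℂ)).const_mul (777 * M)) ?_
  refine (MeasureTheory.Measure.ae_ne MeasureTheory.volume (z : ℂ)).mono fun ζ hζ => ?_
  set κ : ℝ := (‖(z : ℂ) - ζ‖ * (1 + ‖(z : ℂ) - ζ‖ ^ 2))⁻¹ with hκ
  have hκ0 : 0 ≤ κ := by positivity
  have hterm : ∀ i, ‖(χ i ζ : ℂ) * h ζ * (((z : ℂ) - ζ)⁻¹ - (g i z + (ζ - c i) * g i z ^ 2))‖ ≤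
      χ i ζ * (‖h ζ‖ * (777 * κ)) := by
    intro i
    rw [norm_mul, norm_mul, Complex.norm_real, Real.norm_of_nonneg (hχ01 i ζ).1, mul_assoc]
    rcases eq_or_ne (χ i ζ) 0 with h1 | h1
    · simp [h1]
    · refine mul_le_mul_of_nonneg_left (mul_le_mul_of_nonneg_left ?_ (norm_nonneg _)) (hχ01 i ζ).1
      have hball := hχs i (subset_tsupport _ h1)
      rw [Metric.mem_ball, dist_eq_norm] at hball
      have hη : ‖ζ - c i‖ ≤ 4 := by
        calc ‖ζ - c i‖ = ‖(ζ - p i) - (c i - p i)‖ := by congr 1; ring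
          _ ≤ ‖ζ - p i‖ + ‖c i - p i‖ := norm_sub_le _ _
          _ ≤ 4 := by rw [hcp]; linarith
      have hsub : (z : ℂ) - c i - (ζ - c i) = z - ζ := by ring
      have h2 := norm_kernel_sub_inv_le (hρ i) hη (u := z - c i)
        (fun h => hζ (by linear_combination -h)) (hker i z).1 (hker i z).2
      rw [hsub] at h2
      rwa [norm_sub_rev]
  refine (norm_sum_le _ _).trans ((Finset.sum_le_sum fun i _ => hterm i).trans ?_)
  -- The bounds are weighted by a partition of unity, so the total does not depend on the number of
  -- pieces.
  rw [← Finset.sum_mul]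
  by_cases hζT : ζ ∈ tsupport h
  · have h1 := hχ1 hζT
    rw [Finset.sum_apply, Pi.one_apply] at h1
    rw [h1, one_mul]
    have := mul_le_mul_of_nonneg_right (hM ζ) (show 0 ≤ 777 * κ by positivity)
    linarith
  · rw [image_eq_zero_of_notMem_tsupport hζT, norm_zero, zero_mul, mul_zero]
    positivity

/-- Approximation at scale one, with an error controlled by the oscillation at this scale. -/
theorem exists_mem_polyClosure_near_of_oscillation : ∃ C : ℝ, 0 ≤ C ∧
    ∀ (K : Set ℂ) [CompactSpace K], StarConvex ℝ (0 : ℂ) K → (0 : ℂ) ∈ K →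
    ∀ (f : ℂ → ℂ) (ω : ℝ), Continuous f → HasCompactSupport f →
    DifferentiableOn ℂ f (interior K) → (∀ x y, ‖x - y‖ ≤ 1 → ‖f x - f y‖ ≤ ω) →
    ∃ F ∈ polyClosure K, ∀ z : K, ‖f z - F z‖ ≤ C * ω := by
  obtain ⟨M, hM0, hM⟩ := exists_mollification
  set S : ℝ := ∫ ζ : ℂ, (‖ζ‖ * (1 + ‖ζ‖ ^ 2))⁻¹ with hS
  have hS0 : 0 ≤ S := MeasureTheory.integral_nonneg fun ζ => by positivity
  have hpi : 0 < 2 * Real.pi := by positivity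
  refine ⟨1 + (2 * Real.pi)⁻¹ * (777 * M * S), by positivity,
    fun K _ hstar h0 f ω hf hfs hhol hω => ?_⟩
  obtain ⟨Φ, hΦ, hΦs, hΦf, hΦM, hΦ0⟩ := hM f ω hf hfs hω
  -- A point where the derivative is nonzero is within `1` of the complement of `K`. Taking the
  -- closure of such points costs at most another `1`.
  have hnear : ∀ ζ ∈ tsupport (wirtinger Φ), ∃ p ∉ K, ‖ζ - p‖ < 2 := by
    intro ζ hζ
    obtain ⟨ξ, hξ, hd⟩ := Metric.mem_closure_iff.1 hζ 1 one_pos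
    have hnot : ¬ Metric.ball ξ 1 ⊆ K := fun hsub => hξ <| hΦ0 ξ <|
      hhol.mono (interior_maximal hsub Metric.isOpen_ball)
    obtain ⟨p, hp, hpK⟩ := Set.not_subset.1 hnot
    refine ⟨p, hpK, ?_⟩
    rw [Metric.mem_ball] at hp
    rw [← dist_eq_norm]
    have := dist_triangle ζ ξ p
    rw [dist_comm ξ p] at this
    linarith
  obtain ⟨F, hF, hFz⟩ := exists_mem_polyClosure_near_cauchyTransform hstar h0
    (continuous_wirtinger hΦ) (hasCompactSupport_wirtinger hΦs) hΦM hnear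
  refine ⟨(2 * Real.pi : ℂ)⁻¹ • F, Subalgebra.smul_mem _ hF _, fun z => ?_⟩
  have h1 := hFz z
  rw [integral_wirtinger_mul_inv hΦ hΦs, ← hS] at h1
  have hpiC : (2 * Real.pi : ℂ) ≠ 0 := by exact_mod_cast hpi.ne'
  have h2 : Φ z - ((2 * Real.pi : ℂ)⁻¹ • F) z = (2 * Real.pi : ℂ)⁻¹ * (2 * Real.pi * Φ z - F z) := by
    rw [ContinuousMap.smul_apply, smul_eq_mul]
    field_simp
  have h3 : ‖Φ z - ((2 * Real.pi : ℂ)⁻¹ • F) z‖ ≤ (2 * Real.pi)⁻¹ * (777 * (M * ω) * S) := by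
    rw [h2, norm_mul, norm_inv]
    have : ‖(2 * Real.pi : ℂ)‖ = 2 * Real.pi := by
      rw [norm_mul, Complex.norm_real, Real.norm_of_nonneg Real.pi_pos.le, Complex.norm_ofNat]
    rw [this]
    exact mul_le_mul_of_nonneg_left h1 (by positivity)
  have h4 := hΦf z
  rw [norm_sub_rev] at h4
  have h5 := norm_sub_le_norm_sub_add_norm_sub (f z) (Φ z) (((2 * Real.pi : ℂ)⁻¹ • F) z)
  calc _ ≤ _ := h5
    _ ≤ ω + (2 * Real.pi)⁻¹ * (777 * (M * ω) * S) := add_le_add h4 h3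
    _ = _ := by ring

/-- **Mergelyan's theorem** for starlike compact sets. -/
theorem exists_polynomial_near_of_starConvex {K : Set ℂ} (hK : IsCompact K)
    (hstar : StarConvex ℝ (0 : ℂ) K) (h0 : (0 : ℂ) ∈ K) {f : ℂ → ℂ} (hf : ContinuousOn f K)
    (hhol : DifferentiableOn ℂ f (interior K)) {ε : ℝ} (hε : 0 < ε) :
    ∃ P : Polynomial ℂ, ∀ z ∈ K, ‖f z - P.eval z‖ < ε := by
  obtain ⟨C, hC0, hC⟩ := exists_mem_polyClosure_near_of_oscillation
  obtain ⟨f₁, hf₁⟩ := ContinuousMap.exists_restrict_eq hK.isClosed ⟨K.domRestrict f, hf.domRestrict⟩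
  obtain ⟨χ, hχ1, -, hχs, -⟩ := exists_continuous_one_zero_of_isCompact hK isClosed_empty
    (Set.disjoint_empty K)
  set f₂ : ℂ → ℂ := fun z => (χ z : ℂ) * f₁ z with hf₂
  have hf₂c : Continuous f₂ := by fun_prop
  have hf₂s : HasCompactSupport f₂ := HasCompactSupport.mul_right <| hχs.mono fun z hz => by
    contrapose! hz
    simp only [Function.mem_support, not_not] at hz ⊢
    simp [hz]
  have hf₂K : ∀ z ∈ K, f₂ z = f z := by
    intro z hz
    have h1 := congrArg (fun φ : C(K, ℂ) => φ ⟨z, hz⟩) hf₁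
    have h2 : f₁ z = f z := h1
    simp [hf₂, hχ1 hz, h2]
  have huc := hf₂s.uniformContinuous_of_continuous hf₂c
  set ω : ℝ := ε / (2 * (C + 1)) with hω
  have hω0 : 0 < ω := by positivity
  obtain ⟨δ', hδ', hδ⟩ := Metric.uniformContinuous_iff.1 huc ω hω0
  -- After rescaling by `δ`, distance at most one becomes distance strictly less than `δ'`, where
  -- `f₂` oscillates by less than `ω`. The constant `C` does not depend on `K`, so it survives the
  -- rescaling.
  set δ : ℝ := δ' / 2 with hδdef
  have hδ0 : 0 < δ := by positivity
  have hδC : (δ : ℂ) ≠ 0 := by exact_mod_cast hδ0.ne'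
  set K' : Set ℂ := (fun z => (δ : ℂ) * z) ⁻¹' K with hK'
  let e : ℂ ≃ₜ ℂ := Homeomorph.mulLeft₀ (δ : ℂ) hδC
  have hK'c : IsCompact K' := e.isCompact_preimage.2 hK
  have : CompactSpace K' := isCompact_iff_compactSpace.1 hK'c
  have hstar' : StarConvex ℝ (0 : ℂ) K' := by
    rw [starConvex_zero_iff] at hstar ⊢
    intro z hz t ht0 ht1
    have := hstar hz ht0 ht1
    simp only [hK', Set.mem_preimage]
    rwa [mul_smul_comm]
  have hint : interior K' = e ⁻¹' interior K := (e.preimage_interior K).symm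
  obtain ⟨F, hF, hFz⟩ := hC K' hstar' (by simpa [hK'] using h0) (fun z => f₂ (δ * z)) ω
    (by fun_prop) (hf₂s.comp_homeomorph e) (by
      rw [hint]
      have h2 : DifferentiableOn ℂ f₂ (interior K) :=
        hhol.congr fun z hz => hf₂K z (interior_subset hz)
      exact h2.comp (by fun_prop) fun z hz => hz) (by
      intro x y hxy
      rw [← dist_eq_norm]
      refine (hδ ?_).le
      rw [dist_eq_norm, ← mul_sub, norm_mul, Complex.norm_real, Real.norm_of_nonneg hδ0.le]
      nlinarith)
  obtain ⟨P, hP⟩ := exists_poly_of_mem_polyClosure hF (half_pos hε)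
  refine ⟨P.comp (Polynomial.C (δ : ℂ)⁻¹ * Polynomial.X), fun z hz => ?_⟩
  have hz' : (δ : ℂ) * ((δ : ℂ)⁻¹ * z) = z := by field_simp
  have hmem : (δ : ℂ)⁻¹ * z ∈ K' := by
    simp only [hK', Set.mem_preimage]
    rwa [hz']
  have h1 := hFz ⟨_, hmem⟩
  have h2 := hP ⟨_, hmem⟩
  simp only [hz', hf₂K z hz] at h1
  have h3 : C * ω < ε / 2 := by
    rw [hω, ← mul_div_assoc, div_lt_iff₀ (by positivity)]
    nlinarith
  simp only [Polynomial.eval_comp, Polynomial.eval_mul, Polynomial.eval_C, Polynomial.eval_X]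
  have h4 := norm_sub_le_norm_sub_add_norm_sub (f z) (F ⟨_, hmem⟩) (P.eval ((δ : ℂ)⁻¹ * z))
  linarith

/-! ### Quaternionic slices and axial symmetry. -/

theorem slicePoint_eq_smul (I : ℍ[ℝ]) (x y : ℝ) : slicePoint I x y = x • (1 : ℍ[ℝ]) + y • I := by
  rw [slicePoint, Quaternion.mul_coe_eq_smul]
  congr 1
  rw [← Quaternion.coe_mul_eq_smul, mul_one]

theorem mul_self_of_mem_imagUnits {J : ℍ[ℝ]} (hJ : J ∈ imagUnits) : J * J = -1 := by
  have h1 : star J = -J := by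
    rw [Quaternion.star_eq_two_re_sub, hJ.1]; simp
  have h2 := Quaternion.self_mul_star J
  rw [h1, Quaternion.normSq_eq_norm_mul_self, hJ.2] at h2
  rw [mul_neg] at h2
  rw [← neg_neg (J * J), h2]
  simp

theorem neg_mem_imagUnits {J : ℍ[ℝ]} (hJ : J ∈ imagUnits) : -J ∈ imagUnits :=
  ⟨by simp [hJ.1], by simp [hJ.2]⟩

theorem slicePoint_neg (J : ℍ[ℝ]) (x y : ℝ) : slicePoint (-J) x y = slicePoint J x (-y) := by
  simp [slicePoint]

/-- The imaginary unit `i`. -/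
def quatI : ℍ[ℝ] := ⟨0, 1, 0, 0⟩

@[simp] theorem quatI_re : quatI.re = 0 := rfl
@[simp] theorem quatI_imI : quatI.imI = 1 := rfl
@[simp] theorem quatI_imJ : quatI.imJ = 0 := rfl
@[simp] theorem quatI_imK : quatI.imK = 0 := rfl

/-- The imaginary unit `j`. -/
def quatJ : ℍ[ℝ] := ⟨0, 0, 1, 0⟩

@[simp] theorem quatJ_re : quatJ.re = 0 := rfl
@[simp] theorem quatJ_imI : quatJ.imI = 0 := rfl
@[simp] theorem quatJ_imJ : quatJ.imJ = 1 := rfl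
@[simp] theorem quatJ_imK : quatJ.imK = 0 := rfl

theorem norm_eq_one_of_normSq {q : ℍ[ℝ]} (h : normSq q = 1) : ‖q‖ = 1 := by
  rw [Quaternion.normSq_eq_norm_mul_self] at h
  nlinarith [norm_nonneg q]

theorem quatI_mem_imagUnits : quatI ∈ imagUnits :=
  ⟨rfl, norm_eq_one_of_normSq (by simp [Quaternion.normSq_def'])⟩

theorem norm_quatJ : ‖quatJ‖ = 1 :=
  norm_eq_one_of_normSq (by simp [Quaternion.normSq_def'])

theorem slicePoint_quatI (z : ℂ) : slicePoint quatI z.re z.im = (z : ℍ[ℝ]) := by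
  rw [slicePoint_eq_smul]
  ext <;> simp

theorem exists_eq_slicePoint (q : ℍ[ℝ]) : ∃ J ∈ imagUnits, q = slicePoint J q.re ‖q.im‖ := by
  rcases eq_or_ne q.im 0 with h | h
  · refine ⟨quatI, quatI_mem_imagUnits, ?_⟩
    rw [slicePoint, h]
    conv_lhs => rw [← q.re_add_im, h]
    simp
  · have hn : ‖q.im‖ ≠ 0 := norm_ne_zero_iff.2 h
    refine ⟨‖q.im‖⁻¹ • q.im, ⟨by simp, by rw [norm_smul, norm_inv, norm_norm,
      inv_mul_cancel₀ hn]⟩, ?_⟩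
    rw [slicePoint_eq_smul, smul_smul, mul_inv_cancel₀ hn, one_smul]
    conv_lhs => rw [← q.re_add_im]
    rw [← Quaternion.coe_mul_eq_smul, mul_one]

theorem re_slicePoint {J : ℍ[ℝ]} (hJ : J ∈ imagUnits) (x y : ℝ) : (slicePoint J x y).re = x := by
  simp [slicePoint_eq_smul, hJ.1]

theorem norm_im_slicePoint {J : ℍ[ℝ]} (hJ : J ∈ imagUnits) (x y : ℝ) :
    ‖(slicePoint J x y).im‖ = |y| := by
  have h1 : J.im = J := by
    conv_rhs => rw [← J.re_add_im, hJ.1]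
    simp
  rw [slicePoint_eq_smul, Quaternion.im_add, Quaternion.im_smul, Quaternion.im_smul, h1]
  simp [norm_smul, hJ.2]

theorem IsAxiallySymmetric.slicePoint_abs_mem_iff {U : Set ℍ[ℝ]} (hU : IsAxiallySymmetric U)
    {I J : ℍ[ℝ]} (hI : I ∈ imagUnits) (hJ : J ∈ imagUnits) (x y : ℝ) :
    slicePoint I x |y| ∈ U ↔ slicePoint J x y ∈ U := by
  have key : ∀ I ∈ imagUnits, ∀ J ∈ imagUnits, slicePoint I x y ∈ U ↔ slicePoint J x y ∈ U :=
    fun I hI J hJ => ⟨fun h => hU I hI x y h J hJ, fun h => hU J hJ x y h I hI⟩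
  rcases abs_cases y with ⟨h, -⟩ | ⟨h, -⟩
  · rw [h]; exact key I hI J hJ
  · rw [h, ← slicePoint_neg]; exact key _ (neg_mem_imagUnits hI) J hJ

theorem IsAxiallySymmetric.mem_iff {U : Set ℍ[ℝ]} (hU : IsAxiallySymmetric U) {I : ℍ[ℝ]}
    (hI : I ∈ imagUnits) (q : ℍ[ℝ]) : q ∈ U ↔ slicePoint I q.re ‖q.im‖ ∈ U := by
  obtain ⟨J, hJ, hq⟩ := exists_eq_slicePoint q
  conv_lhs => rw [hq]
  exact ⟨fun h => hU J hJ _ _ h I hI, fun h => hU I hI _ _ h J hJ⟩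

theorem continuous_slicePoint (I : ℍ[ℝ]) : Continuous fun z : ℂ => slicePoint I z.re z.im := by
  simp only [slicePoint_eq_smul]
  fun_prop

/-- If the closure of a regular open set is axially symmetric, a set of the form `{z | x + I y}`
which is open and lies in the slice of the closure lies in the slice of the open set. -/
theorem slicePoint_mem_of_isOpen {Ω : Set ℍ[ℝ]} (hreg : interior (closure Ω) = Ω)
    (hsymm : IsAxiallySymmetric (closure Ω)) {I J : ℍ[ℝ]} (hI : I ∈ imagUnits)
    (hJ : J ∈ imagUnits) {V : Set ℂ} (hV : IsOpen V)
    (hsub : ∀ z ∈ V, slicePoint I z.re z.im ∈ closure Ω) {z : ℂ} (hz : z ∈ V) :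
    slicePoint J z.re z.im ∈ Ω := by
  have hre : Continuous fun q : ℍ[ℝ] => q.re := Quaternion.continuous_re
  have him : Continuous fun q : ℍ[ℝ] => q.im := Quaternion.continuous_im
  -- The preimage of `V` under `q ↦ Re q + i s ‖Im q‖` is open in `ℍ` and, by symmetry, contained in
  -- `closure Ω`, hence in its interior `Ω`. The signs `s = ±1` serve the two half planes.
  have key : ∀ s : ℝ, |s| = 1 → ∀ q : ℍ[ℝ], (⟨q.re, s * ‖q.im‖⟩ : ℂ) ∈ V → q ∈ Ω := by
    intro s hs q hq
    have hcont : Continuous fun q : ℍ[ℝ] => (⟨q.re, s * ‖q.im‖⟩ : ℂ) := by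
      have : (fun q : ℍ[ℝ] => (⟨q.re, s * ‖q.im‖⟩ : ℂ)) =
          fun q : ℍ[ℝ] => Complex.equivRealProdCLM.symm (q.re, s * ‖q.im‖) := by
        rfl
      rw [this]
      fun_prop
    rw [← hreg]
    refine interior_maximal (t := (fun q : ℍ[ℝ] => (⟨q.re, s * ‖q.im‖⟩ : ℂ)) ⁻¹' V) ?_
      (hV.preimage hcont) hq
    intro q hq
    have habs : ‖q.im‖ = |s * ‖q.im‖| := by rw [abs_mul, hs, one_mul, abs_norm]
    refine (hsymm.mem_iff hI q).2 ?_
    rw [habs]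
    exact (hsymm.slicePoint_abs_mem_iff hI hI q.re (s * ‖q.im‖)).2 (hsub _ hq)
  rcases le_total 0 z.im with h | h
  · refine key 1 (by simp) _ ?_
    rw [re_slicePoint hJ, norm_im_slicePoint hJ, abs_of_nonneg h, one_mul]
    exact hz
  · refine key (-1) (by simp) _ ?_
    rw [re_slicePoint hJ, norm_im_slicePoint hJ, abs_of_nonpos h, neg_one_mul, neg_neg]
    exact hz

theorem isAxiallySymmetric_of_closure {Ω : Set ℍ[ℝ]} (hopen : IsOpen Ω)
    (hreg : interior (closure Ω) = Ω) (hsymm : IsAxiallySymmetric (closure Ω)) :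
    IsAxiallySymmetric Ω := fun I hI x y h _ hJ =>
  slicePoint_mem_of_isOpen hreg hsymm hI hJ (hopen.preimage (continuous_slicePoint I))
    (fun _ hz => subset_closure hz) (z := ⟨x, y⟩) h

/-! ### Cauchy-Riemann equations on a slice. -/

/-- The map `x + i y ↦ x + J y`. -/
noncomputable def sliceCLM (J : ℍ[ℝ]) : ℂ →L[ℝ] ℍ[ℝ] :=
  Complex.reCLM.smulRight 1 + Complex.imCLM.smulRight J

theorem sliceCLM_apply (J : ℍ[ℝ]) (z : ℂ) : sliceCLM J z = slicePoint J z.re z.im := by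
  simp [sliceCLM, slicePoint_eq_smul]

@[simp] theorem sliceCLM_one (J : ℍ[ℝ]) : sliceCLM J 1 = 1 := by
  simp [sliceCLM_apply, slicePoint_eq_smul]

@[simp] theorem sliceCLM_I (J : ℍ[ℝ]) : sliceCLM J Complex.I = J := by
  simp [sliceCLM_apply, slicePoint_eq_smul]

/-- The Cauchy-Riemann equation on the slice of `J`, for the full derivative. -/
theorem IsSliceRegularOn.fderiv_apply_unit {f : ℍ[ℝ] → ℍ[ℝ]} {Ω : Set ℍ[ℝ]} (hopen : IsOpen Ω)
    (hf : IsSliceRegularOn f Ω) {J : ℍ[ℝ]} (hJ : J ∈ imagUnits) {z : ℂ} (hz : sliceCLM J z ∈ Ω) :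
    fderiv ℝ f (sliceCLM J z) J = J * fderiv ℝ f (sliceCLM J z) 1 := by
  have hd : HasFDerivAt f (fderiv ℝ f (sliceCLM J z)) (sliceCLM J z) :=
    (hf.1.differentiableAt (hopen.mem_nhds hz)).hasFDerivAt
  rw [sliceCLM_apply] at hz hd ⊢
  set f' := fderiv ℝ f (slicePoint J z.re z.im) with hf'
  have h1 : HasDerivAt (fun t : ℝ => slicePoint J t z.im) 1 z.re := by
    simp only [slicePoint_eq_smul]
    simpa using ((hasDerivAt_id z.re).smul_const (1 : ℍ[ℝ])).add_const (z.im • J)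
  have h2 : HasDerivAt (fun t : ℝ => slicePoint J z.re t) J z.im := by
    simp only [slicePoint_eq_smul]
    simpa using ((hasDerivAt_id z.im).smul_const J).const_add (z.re • (1 : ℍ[ℝ]))
  have h3 := (hd.comp_hasDerivAt z.re h1).deriv
  have h4 := (hd.comp_hasDerivAt z.im h2).deriv
  have h5 := hf.2 J hJ _ _ hz
  have h6 : f' 1 + J * f' J = 0 := by
    rw [← h3, ← h4]
    exact (smul_eq_zero.1 h5).resolve_left (by norm_num)
  have h7 : J * f' 1 - f' J = J * (f' 1 + J * f' J) := by
    rw [mul_add, ← mul_assoc, mul_self_of_mem_imagUnits hJ]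
    simp [sub_eq_add_neg]
  rw [h6, mul_zero, sub_eq_zero] at h7
  exact h7.symm

theorem IsSliceRegularOn.hasFDerivAt_comp_sliceCLM {f : ℍ[ℝ] → ℍ[ℝ]} {Ω : Set ℍ[ℝ]}
    (hopen : IsOpen Ω) (hf : IsSliceRegularOn f Ω) {J : ℍ[ℝ]} (hJ : J ∈ imagUnits) {z : ℂ}
    (hz : sliceCLM J z ∈ Ω) : ∃ g' : ℂ →L[ℝ] ℍ[ℝ],
      HasFDerivAt (fun z => f (sliceCLM J z)) g' z ∧ g' Complex.I = J * g' 1 := by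
  have hd : HasFDerivAt f (fderiv ℝ f (sliceCLM J z)) (sliceCLM J z) :=
    (hf.1.differentiableAt (hopen.mem_nhds hz)).hasFDerivAt
  refine ⟨_, hd.comp z (sliceCLM J).hasFDerivAt, ?_⟩
  simpa using hf.fderiv_apply_unit hopen hJ hz

/-- The complex coordinate `Re (q c) - i Re (J q c)` of `q`, for which the left multiplication
by `J` is the multiplication by `i`. -/
noncomputable def sliceCoord (J c : ℍ[ℝ]) : ℍ[ℝ] →L[ℝ] ℂ :=
  LinearMap.toContinuousLinearMap
    { toFun := fun q => ((q * c).re : ℂ) - ((J * q * c).re : ℂ) * Complex.I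
      map_add' := fun p q => by
        simp only [add_mul, mul_add, Quaternion.re_add, Complex.ofReal_add]; ring
      map_smul' := fun r q => by
        simp only [smul_mul_assoc, mul_smul_comm, Quaternion.re_smul, smul_eq_mul,
          Complex.ofReal_mul, RingHom.id_apply, Complex.real_smul]
        ring }

theorem sliceCoord_apply (J c q : ℍ[ℝ]) :
    sliceCoord J c q = ((q * c).re : ℂ) - ((J * q * c).re : ℂ) * Complex.I := rfl

theorem sliceCoord_mul {J : ℍ[ℝ]} (hJ : J ∈ imagUnits) (c q : ℍ[ℝ]) :
    sliceCoord J c (J * q) = Complex.I * sliceCoord J c q := by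
  rw [sliceCoord_apply, sliceCoord_apply, ← mul_assoc J J q, mul_self_of_mem_imagUnits hJ]
  simp only [neg_mul, one_mul, Quaternion.re_neg, Complex.ofReal_neg]
  linear_combination ((J * q * c).re : ℂ) * Complex.I_mul_I

/-- The coordinate with `c = star q` has real part the squared norm of `q`. -/
theorem eq_zero_of_sliceCoord {J q : ℍ[ℝ]} (h : ∀ c, sliceCoord J c q = 0) : q = 0 := by
  have h1 := congrArg Complex.re (h (star q))
  rw [sliceCoord_apply, Quaternion.self_mul_star] at h1
  simpa using h1

theorem differentiableAt_sliceCoord {J : ℍ[ℝ]} (hJ : J ∈ imagUnits) (c : ℍ[ℝ]) {g : ℂ → ℍ[ℝ]}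
    {g' : ℂ →L[ℝ] ℍ[ℝ]} {z : ℂ} (hg : HasFDerivAt g g' z) (hcr : g' Complex.I = J * g' 1) :
    DifferentiableAt ℂ (fun z => sliceCoord J c (g z)) z := by
  have h1 : HasFDerivAt (fun z => sliceCoord J c (g z)) ((sliceCoord J c).comp g') z :=
    (sliceCoord J c).hasFDerivAt.comp z hg
  rw [differentiableAt_complex_iff_differentiableAt_real]
  refine ⟨h1.differentiableAt, ?_⟩
  rw [h1.fderiv]
  simp [hcr, sliceCoord_mul hJ]

/-- The identity principle on a slice. -/
theorem eq_zero_of_slice_cauchyRiemann {J : ℍ[ℝ]} (hJ : J ∈ imagUnits) {g : ℂ → ℍ[ℝ]} {D : Set ℂ}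
    (hD : IsOpen D) (hpre : IsPreconnected D) (h0 : (0 : ℂ) ∈ D)
    (hg : ∀ z ∈ D, ∃ g' : ℂ →L[ℝ] ℍ[ℝ], HasFDerivAt g g' z ∧ g' Complex.I = J * g' 1)
    (hreal : ∀ x : ℝ, g x = 0) {z : ℂ} (hz : z ∈ D) : g z = 0 := by
  refine eq_zero_of_sliceCoord (J := J) fun c => ?_
  have hdiff : DifferentiableOn ℂ (fun z => sliceCoord J c (g z)) D := by
    intro z hz
    obtain ⟨g', hg', hcr⟩ := hg z hz
    exact (differentiableAt_sliceCoord hJ c hg' hcr).differentiableWithinAt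
  refine (hdiff.analyticOnNhd hD).eqOn_zero_of_preconnected_of_frequently_eq_zero hpre h0 ?_ hz
  have ht : Filter.Tendsto (fun x : ℝ => (x : ℂ)) (𝓝[≠] 0) (𝓝[≠] 0) := by
    refine tendsto_nhdsWithin_iff.2 ⟨?_, ?_⟩
    · have : Filter.Tendsto (fun x : ℝ => (x : ℂ)) (𝓝 0) (𝓝 ((0 : ℝ) : ℂ)) :=
        Complex.continuous_ofReal.tendsto 0
      exact (this.mono_left nhdsWithin_le_nhds)
    · filter_upwards [self_mem_nhdsWithin] with x hx
      simpa using hx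
  exact ht.frequently (Filter.Frequently.of_forall fun x => by simp [hreal x])

/-! ### The representation formula. -/

/-- The value at `x + J y` given by the representation formula from the values at `x + i y` and
`x - i y`. -/
noncomputable def sliceRep (J a b : ℍ[ℝ]) : ℍ[ℝ] :=
  (1 / 2 : ℝ) • ((1 - J * quatI) * a + (1 + J * quatI) * b)

theorem sliceRep_self (J a : ℍ[ℝ]) : sliceRep J a a = a := by
  rw [sliceRep, ← add_mul, sub_add_add_cancel, one_add_one_eq_two, two_mul, smul_add, ← add_smul]
  norm_num

theorem sliceRep_sub (J a b a' b' : ℍ[ℝ]) :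
    sliceRep J a b - sliceRep J a' b' = sliceRep J (a - a') (b - b') := by
  simp only [sliceRep, ← smul_sub, mul_sub]
  congr 1
  abel

theorem sliceRep_mul (J a b c : ℍ[ℝ]) : sliceRep J a b * c = sliceRep J (a * c) (b * c) := by
  simp only [sliceRep, smul_mul_assoc, add_mul, mul_assoc]

theorem sliceRep_sum (J : ℍ[ℝ]) (s : Finset ℕ) (a b : ℕ → ℍ[ℝ]) :
    ∑ k ∈ s, sliceRep J (a k) (b k) = sliceRep J (∑ k ∈ s, a k) (∑ k ∈ s, b k) := by
  simp only [sliceRep, ← Finset.smul_sum, Finset.sum_add_distrib, ← Finset.mul_sum]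

theorem norm_sliceRep_le {J : ℍ[ℝ]} (hJ : J ∈ imagUnits) (a b : ℍ[ℝ]) :
    ‖sliceRep J a b‖ ≤ ‖a‖ + ‖b‖ := by
  have h1 : ‖J * quatI‖ = 1 := by rw [norm_mul, hJ.2, quatI_mem_imagUnits.2, one_mul]
  have h2 : ‖1 - J * quatI‖ ≤ 2 := (norm_sub_le _ _).trans (by rw [h1, norm_one]; norm_num)
  have h3 : ‖1 + J * quatI‖ ≤ 2 := (norm_add_le _ _).trans (by rw [h1, norm_one]; norm_num)
  rw [sliceRep, norm_smul, Real.norm_of_nonneg (by norm_num)]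
  have h4 := norm_add_le ((1 - J * quatI) * a) ((1 + J * quatI) * b)
  rw [norm_mul, norm_mul] at h4
  nlinarith [norm_nonneg a, norm_nonneg b]

/-- Follows from `J (1 - J i) = (1 - J i) i` and its conjugate. It transfers the Cauchy-Riemann
equations on the slices of `i` and `-i` to that of `J`. -/
theorem mul_sliceRep {J : ℍ[ℝ]} (hJ : J ∈ imagUnits) (a b : ℍ[ℝ]) :
    J * sliceRep J a b = sliceRep J (quatI * a) (-quatI * b) := by
  have hJJ := mul_self_of_mem_imagUnits hJ
  have hii := mul_self_of_mem_imagUnits quatI_mem_imagUnits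
  have h1 : J * (1 - J * quatI) = (1 - J * quatI) * quatI := by
    rw [mul_sub, ← mul_assoc, hJJ, sub_mul, mul_assoc J, hii]
    simp [add_comm]
  have h2 : J * (1 + J * quatI) = (1 + J * quatI) * -quatI := by
    rw [mul_add, ← mul_assoc, hJJ, add_mul, mul_neg, mul_neg, mul_assoc J, hii]
    simp [add_comm]
  simp only [sliceRep, mul_smul_comm, mul_add]
  rw [← mul_assoc J (1 - _), ← mul_assoc J (1 + _), h1, h2, mul_assoc, mul_assoc]

/-- The representation formula for slice regular functions. -/
theorem IsSliceRegularOn.eq_sliceRep {f : ℍ[ℝ] → ℍ[ℝ]} {Ω : Set ℍ[ℝ]} (hopen : IsOpen Ω)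
    (hf : IsSliceRegularOn f Ω) (hstar : StarConvex ℝ (0 : ℍ[ℝ]) Ω) (h0 : (0 : ℍ[ℝ]) ∈ Ω)
    (hsymm : IsAxiallySymmetric Ω) {J : ℍ[ℝ]} (hJ : J ∈ imagUnits) {z : ℂ}
    (hz : sliceCLM J z ∈ Ω) :
    f (sliceCLM J z) = sliceRep J (f (sliceCLM quatI z)) (f (sliceCLM (-quatI) z)) := by
  have hI := quatI_mem_imagUnits
  have hall : ∀ z, sliceCLM J z ∈ Ω → ∀ I ∈ imagUnits, sliceCLM I z ∈ Ω := by
    intro z hz I hI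
    rw [sliceCLM_apply] at hz ⊢
    exact hsymm J hJ _ _ hz I hI
  rw [← sub_eq_zero]
  refine eq_zero_of_slice_cauchyRiemann hJ (D := sliceCLM J ⁻¹' Ω)
    (g := fun z => f (sliceCLM J z) - sliceRep J (f (sliceCLM quatI z)) (f (sliceCLM (-quatI) z)))
    (hopen.preimage (sliceCLM J).continuous) ?_ (by simpa using h0) ?_ ?_ hz
  · have h1 : StarConvex ℝ (0 : ℂ) (sliceCLM J ⁻¹' Ω) :=
      StarConvex.linear_preimage (sliceCLM J : ℂ →ₗ[ℝ] ℍ[ℝ]) (by simpa using hstar)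
    exact (h1.isPathConnected (by simpa using h0)).isConnected.isPreconnected
  · intro w hw
    obtain ⟨g', hg', hcr⟩ := hf.hasFDerivAt_comp_sliceCLM hopen hJ hw
    obtain ⟨a', ha', hcra⟩ := hf.hasFDerivAt_comp_sliceCLM hopen hI (hall w hw _ hI)
    obtain ⟨b', hb', hcrb⟩ := hf.hasFDerivAt_comp_sliceCLM hopen (neg_mem_imagUnits hI)
      (hall w hw _ (neg_mem_imagUnits hI))
    refine ⟨_, hg'.sub (((ha'.const_mul (1 - J * quatI)).add
      (hb'.const_mul (1 + J * quatI))).const_smul (1 / 2 : ℝ)), ?_⟩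
    have h1 := mul_sliceRep hJ (a' 1) (b' 1)
    rw [← hcra, ← hcrb] at h1
    simp only [sliceRep] at h1
    simp only [sub_apply, smul_apply, add_apply, smul_eq_mul, mul_sub, hcr, h1]
  -- All slices share the real axis, where both sides of the formula reduce to `f x`.
  · intro x
    have h1 : ∀ I, sliceCLM I (x : ℂ) = (x : ℝ) • 1 := fun I => by
      simp [sliceCLM_apply, slicePoint_eq_smul]
    simp only [h1, sliceRep_self, sub_self]

theorem slicePoint_mul {J : ℍ[ℝ]} (hJ : J ∈ imagUnits) (x y u v : ℝ) :
    slicePoint J x y * slicePoint J u v = slicePoint J (x * u - y * v) (x * v + y * u) := by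
  simp only [slicePoint_eq_smul, add_mul, mul_add, smul_mul_assoc, mul_smul_comm, one_mul, mul_one,
    mul_self_of_mem_imagUnits hJ]
  module

theorem slicePoint_pow {J : ℍ[ℝ]} (hJ : J ∈ imagUnits) (z : ℂ) (k : ℕ) :
    slicePoint J z.re z.im ^ k = slicePoint J (z ^ k).re (z ^ k).im := by
  induction k with
  | zero => simp [slicePoint]
  | succ k ih =>
    rw [pow_succ, ih, slicePoint_mul hJ, pow_succ, Complex.mul_re, Complex.mul_im]

theorem slicePoint_eq_sliceRep (J : ℍ[ℝ]) (x y : ℝ) :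
    slicePoint J x y = sliceRep J (slicePoint quatI x y) (slicePoint (-quatI) x y) := by
  simp only [sliceRep, slicePoint_eq_smul, mul_add, sub_mul, add_mul, one_mul, mul_smul_comm,
    mul_one, mul_assoc, mul_neg, mul_self_of_mem_imagUnits quatI_mem_imagUnits]
  module

/-- Right coefficients commute with the formula, whose operators act on the left, and powers of `x +
Jy` stay in the slice. -/
theorem rightPoly_eq_sliceRep (n : ℕ) (a : ℕ → ℍ[ℝ]) {J : ℍ[ℝ]} (hJ : J ∈ imagUnits) (z : ℂ) :
    rightPoly n a (sliceCLM J z) =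
      sliceRep J (rightPoly n a (sliceCLM quatI z)) (rightPoly n a (sliceCLM (-quatI) z)) := by
  simp only [rightPoly, sliceCLM_apply, slicePoint_pow hJ, slicePoint_pow quatI_mem_imagUnits,
    slicePoint_pow (neg_mem_imagUnits quatI_mem_imagUnits)]
  rw [← sliceRep_sum]
  refine Finset.sum_congr rfl fun k _ => ?_
  rw [← sliceRep_mul, ← slicePoint_eq_sliceRep]

/-! ### Splitting into complex components, and the conclusion. -/

theorem eq_coeComplex_add_mul_quatJ (q : ℍ[ℝ]) :
    q = (sliceCoord quatI 1 q : ℍ[ℝ]) + (sliceCoord quatI (-quatJ) q : ℍ[ℝ]) * quatJ := by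
  ext <;> simp [sliceCoord_apply]

theorem exists_rightPoly_coeComplex (P Q : Polynomial ℂ) : ∃ (n : ℕ) (a : ℕ → ℍ[ℝ]),
    ∀ z : ℂ, rightPoly n a (z : ℍ[ℝ]) = ((P.eval z : ℂ) : ℍ[ℝ]) + ((Q.eval z : ℂ) : ℍ[ℝ]) * quatJ := by
  set n := max P.natDegree Q.natDegree with hn
  refine ⟨n, fun k => (P.coeff k : ℍ[ℝ]) + (Q.coeff k : ℍ[ℝ]) * quatJ, fun z => ?_⟩
  rw [P.eval_eq_sum_range' (Nat.lt_succ_of_le (le_max_left P.natDegree Q.natDegree)),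
    Q.eval_eq_sum_range' (Nat.lt_succ_of_le (le_max_right P.natDegree Q.natDegree))]
  have hcoe : ∀ w : ℂ, (w : ℍ[ℝ]) = Quaternion.ofComplex w := fun _ => rfl
  simp only [rightPoly, hcoe, map_sum, map_mul, map_pow, Finset.sum_mul,
    ← Finset.sum_add_distrib, mul_add, ← mul_assoc]
  refine Finset.sum_congr rfl fun k _ => ?_
  rw [← map_pow, ← map_mul, ← map_mul, mul_comm (z ^ k), mul_comm (z ^ k), map_mul, map_mul]

theorem norm_coeComplex_eq (w : ℂ) : ‖(w : ℍ[ℝ])‖ = ‖w‖ := by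
  rw [← sq_eq_sq₀ (norm_nonneg _) (norm_nonneg _), sq, ← Quaternion.normSq_eq_norm_mul_self,
    Complex.sq_norm, Quaternion.normSq_def', Complex.normSq_apply]
  simp
  ring

/-- Polynomial approximation on the slice of `i`. -/
theorem exists_rightPoly_near_on_slice {Ω : Set ℍ[ℝ]} (hopen : IsOpen Ω)
    (hbdd : Bornology.IsBounded Ω) (hstar : StarConvex ℝ (0 : ℍ[ℝ]) Ω) (h0 : (0 : ℍ[ℝ]) ∈ Ω)
    (hreg : interior (closure Ω) = Ω) (hsymm : IsAxiallySymmetric (closure Ω))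
    {f : ℍ[ℝ] → ℍ[ℝ]} (hf : IsSliceRegularOn f Ω) (hcont : ContinuousOn f (closure Ω))
    {ε : ℝ} (hε : 0 < ε) : ∃ (n : ℕ) (a : ℕ → ℍ[ℝ]), ∀ z : ℂ, sliceCLM quatI z ∈ closure Ω →
      ‖f (sliceCLM quatI z) - rightPoly n a (sliceCLM quatI z)‖ < ε := by
  have hI := quatI_mem_imagUnits
  set K : Set ℂ := sliceCLM quatI ⁻¹' closure Ω with hK
  have hcoe : ∀ z : ℂ, sliceCLM quatI z = (z : ℍ[ℝ]) := fun z => by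
    rw [sliceCLM_apply, slicePoint_quatI]
  have hKc : IsCompact K := by
    refine Metric.isCompact_of_isClosed_isBounded
      (isClosed_closure.preimage (sliceCLM quatI).continuous) ?_
    obtain ⟨C, hC⟩ := hbdd.closure.exists_norm_le
    refine isBounded_iff_forall_norm_le.2 ⟨C, fun z hz => ?_⟩
    rw [← norm_coeComplex_eq, ← hcoe]
    exact hC _ hz
  have hKstar : StarConvex ℝ (0 : ℂ) K := by
    have h1 : StarConvex ℝ (0 : ℍ[ℝ]) (closure Ω) := by
      rw [starConvex_zero_iff] at hstar ⊢
      intro q hq t ht0 ht1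
      exact map_mem_closure (continuous_const_smul t) hq fun p hp => hstar hp ht0 ht1
    exact StarConvex.linear_preimage (sliceCLM quatI : ℂ →ₗ[ℝ] ℍ[ℝ]) (by simpa using h1)
  have hK0 : (0 : ℂ) ∈ K := by simpa [hK] using subset_closure h0
  -- The planar interior of the slice of the closure could a priori exceed the slice of `Ω`.
  -- Regularity of `Ω` and axial symmetry exclude this, so the components are holomorphic in all of
  -- `interior K`.
  have hint : ∀ z ∈ interior K, sliceCLM quatI z ∈ Ω := by
    intro z hz
    rw [sliceCLM_apply]
    refine slicePoint_mem_of_isOpen hreg hsymm hI hI isOpen_interior (fun w hw => ?_) hz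
    rw [← sliceCLM_apply]
    exact (interior_subset hw : w ∈ K)
  have happrox : ∀ c : ℍ[ℝ], ∃ P : Polynomial ℂ, ∀ z ∈ K,
      ‖sliceCoord quatI c (f (sliceCLM quatI z)) - P.eval z‖ < ε / 2 := by
    intro c
    refine exists_polynomial_near_of_starConvex hKc hKstar hK0
      (f := fun z => sliceCoord quatI c (f (sliceCLM quatI z))) ?_ ?_ (half_pos hε)
    · exact (sliceCoord quatI c).continuous.comp_continuousOn
        (hcont.comp (sliceCLM quatI).continuous.continuousOn fun z hz => hz)
    · intro z hz
      obtain ⟨g', hg', hcr⟩ := hf.hasFDerivAt_comp_sliceCLM hopen hI (hint z hz)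
      exact (differentiableAt_sliceCoord hI c hg' hcr).differentiableWithinAt
  obtain ⟨P, hP⟩ := happrox 1
  obtain ⟨Q, hQ⟩ := happrox (-quatJ)
  obtain ⟨n, a, ha⟩ := exists_rightPoly_coeComplex P Q
  refine ⟨n, a, fun z hz => ?_⟩
  have h1 : f (sliceCLM quatI z) - rightPoly n a (sliceCLM quatI z) =
      ((sliceCoord quatI 1 (f (sliceCLM quatI z)) - P.eval z : ℂ) : ℍ[ℝ]) +
      ((sliceCoord quatI (-quatJ) (f (sliceCLM quatI z)) - Q.eval z : ℂ) : ℍ[ℝ]) * quatJ := by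
    rw [hcoe z, ha, ← hcoe z]
    conv_lhs => rw [eq_coeComplex_add_mul_quatJ (f (sliceCLM quatI z))]
    have hsub : ∀ u v : ℂ, ((u - v : ℂ) : ℍ[ℝ]) = (u : ℍ[ℝ]) - (v : ℍ[ℝ]) :=
      fun u v => map_sub Quaternion.ofComplex u v
    rw [hsub, hsub, sub_mul]
    abel
  rw [h1]
  refine (norm_add_le _ _).trans_lt ?_
  rw [norm_mul, norm_quatJ, mul_one, norm_coeComplex_eq, norm_coeComplex_eq]
  linarith [hP z hz, hQ z hz]

theorem mainTheorem3 (Ω : Set ℍ[ℝ])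
    (hopen : IsOpen Ω) (hconn : IsConnected Ω) (hbdd : Bornology.IsBounded Ω)
    (hstar : StarConvex ℝ (0 : ℍ[ℝ]) Ω)
    (hreg : interior (closure Ω) = Ω)
    (hsymm : IsAxiallySymmetric (closure Ω))
    (hcompl : IsConnected (extendedComplement (closure Ω)))
    (hslice : ∀ I ∈ imagUnits, IsConnected (extendedSliceComplement I (closure Ω)))
    (f : ℍ[ℝ] → ℍ[ℝ]) (hf : IsSliceRegularOn f Ω) (hcont : ContinuousOn f (closure Ω)) :
    ∀ ε : ℝ, 0 < ε → ∃ (n : ℕ) (a : ℕ → ℍ[ℝ]),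
      ∀ q ∈ closure Ω, ‖f q - rightPoly n a q‖ < ε := by
  intro ε hε
  have h0 : (0 : ℍ[ℝ]) ∈ Ω := hstar.mem hconn.nonempty
  have hI := quatI_mem_imagUnits
  have hsymmΩ := isAxiallySymmetric_of_closure hopen hreg hsymm
  obtain ⟨n, a, ha⟩ := exists_rightPoly_near_on_slice hopen hbdd hstar h0 hreg hsymm hf hcont
    (show 0 < ε / 4 by positivity)
  refine ⟨n, a, fun q hq => ?_⟩
  -- The formula holds in `Ω` and adds two errors of `ε / 4`. Points of the closure follow by
  -- continuity, with `ε / 2` left to make the inequality strict.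
  have hopenbound : ∀ q ∈ Ω, ‖f q - rightPoly n a q‖ ≤ ε / 2 := by
    intro q hq
    obtain ⟨J, hJ, hqJ⟩ := exists_eq_slicePoint q
    set z : ℂ := ⟨q.re, ‖q.im‖⟩ with hz
    have hqz : q = sliceCLM J z := by rw [sliceCLM_apply]; exact hqJ
    have hmem : sliceCLM J z ∈ Ω := hqz ▸ hq
    have hneg : sliceCLM (-quatI) z = sliceCLM quatI ((starRingEnd ℂ) z) := by
      simp [sliceCLM_apply, slicePoint_neg]
    have hmem' : ∀ I ∈ imagUnits, sliceCLM I z ∈ closure Ω := by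
      intro I hI
      rw [sliceCLM_apply] at hmem ⊢
      exact subset_closure (hsymmΩ J hJ _ _ hmem I hI)
    have h1 := ha z (hmem' _ hI)
    have h2 := ha ((starRingEnd ℂ) z) (hneg ▸ hmem' _ (neg_mem_imagUnits hI))
    rw [← hneg] at h2
    rw [hqz, hf.eq_sliceRep hopen hstar h0 hsymmΩ hJ hmem, rightPoly_eq_sliceRep n a hJ,
      sliceRep_sub]
    refine (norm_sliceRep_le hJ _ _).trans ?_
    linarith
  have hpoly : Continuous (rightPoly n a) := by
    unfold rightPoly
    fun_prop
  have hclosed : ‖f q - rightPoly n a q‖ ≤ ε / 2 := by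
    have hc : ContinuousWithinAt (fun q => ‖f q - rightPoly n a q‖) Ω q :=
      ((hcont.sub hpoly.continuousOn).norm q hq).mono subset_closure
    have : Filter.NeBot (𝓝[Ω] q) := mem_closure_iff_nhdsWithin_neBot.1 hq
    exact le_of_tendsto hc (Filter.eventually_of_mem self_mem_nhdsWithin hopenbound)
  linarith
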